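/- Let $d\ge 0$ and $m\ge 0$ be integers and let $\ell\ge 1$ be an integer. Let $G$ be a finite group acting faithfully on $\mathbb{R}^d$ by continuous (linear) automorphisms $x\mapsto gx$ with $g\mathbb{Z}^d=\mathbb{Z}^d$ for all $g\in G$, and let $\Gamma=\mathbb{Z}^d\rtimes G$. On $L^2(\mathbb{R}^d)$ (complex-valued functions) put $t_kf(x)=f(x-k)$ for $k\in\mathbb{Z}^d$ and $R_gf(x)=f(g^{-1}x)$ for $g\in G$; the element $(k,g)\in\Gamma$ acts by $t_kR_g$. For a finite family $\Phi=\{\varphi_1,\dots,\varphi_n\}\subset L^2(\mathbb{R}^d)$ let $$S_\Gamma(\Phi)=\overline{\operatorname{span}}\{t_kR_g\varphi_i : k\in\mathbb{Z}^d,\ g\in G,\ 1\le i\le n\}.$$ The length of a closed $\Gamma$-invariant subspace $S$ is the least $n$ such that $S=S_\Gamma(\Phi)$ for some family $\Phi$ of $n$ functions in $L^2(\mathbb{R}^d)$ ($\infty$ if there is none). Let $\Omega\subset\mathbb{R}^d$ be a measurable set of frequencies that is invariant under the (dual) action of $G$ on the frequency space, that is, $(g^{-1})^{T}\Omega=\Omega$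 for all $g\in G$; when $G$ acts by orthogonal maps this says $g\Omega=\Omega$ for all $g\in G$. Let $PW_\Omega=\{f\in L^2(\mathbb{R}^d):\hat f=0 \text{ a.e. on } \mathbb{R}^d\setminus\Omega\}$, where $\hat f$ is the Fourier transform, normalized by $\hat f(\omega)=\int f(x)e^{-2\pi i\langle x,\omega\rangle}\,dx$. Let $\mathcal{C}_\ell(\Omega)$ be the class of closed $\Gamma$-invariant subspaces of $L^2(\mathbb{R}^d)$ of length at most $\ell$ that are contained in $PW_\Omega$. For data $\mathcal{F}=\{f_1,\dots,f_m\}\subset L^2(\mathbb{R}^d)$ and a closed subspace $S$ with orthogonal projection $\mathbb{P}_S$, let $\mathcal{E}(\mathcal{F},S)=\sum_{i=1}^m\|f_i-\mathbb{P}_Sf_i\|^2$. Then for all such data there is a family $\Phi=\{\varphi_1,\dots,\varphi_\ell\}$ such that $S_\Gamma(\Phi)\in\mathcal{C}_\ell(\Omega)$ and $$\mathcal{E}(\mathcal{F},S_\Gamma(\Phi))\le\mathcal{E}(\mathcal{F},S_\Gamma(\Psi))\qquad\text{for all families } \Psi=\{\psi_1,\dots,\psi_\ell\}\subset PW_\Omega.$$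 -/

import Mathlib

open MeasureTheory
open scoped FourierTransform

noncomputable section

/-- Euclidean space `ℝ^d`. -/
abbrev Eucl (d : ℕ) : Type := EuclideanSpace ℝ (Fin d)

/-- The Hilbert space `L²(ℝ^d)` of complex-valued functions. -/
abbrev L2 (d : ℕ) : Type := Lp ℂ 2 (volume : Measure (Eucl d))

/-- The vector of `ℝ^d` with the integer coordinates `k`. -/
def intVec {d : ℕ} (k : Fin d → ℤ) : Eucl d := WithLp.toLp 2 fun i => (k i : ℝ)

/-- The lattice `ℤ^d` in `ℝ^d`. -/
def intLattice (d : ℕ) : Set (Eucl d) := Set.range intVec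

/-- A finite group of linear automorphisms preserves Lebesgue measure. -/
theorem measurePreserving_of_finite {d : ℕ} {G : Type*} [Group G] [Finite G]
    (ρ : G →* (Eucl d ≃L[ℝ] Eucl d)) (g : G) :
    MeasurePreserving (ρ g) (volume : Measure (Eucl d)) volume := by
  let D : (Eucl d ≃L[ℝ] Eucl d) →* ℝ :=
    { toFun := fun A => LinearMap.det (A : Eucl d →ₗ[ℝ] Eucl d)
      map_one' := LinearMap.det_id
      map_mul' := fun A B => LinearMap.det_comp _ _ }
  have h1 : D (ρ g) ^ orderOf g = 1 := by
    rw [← map_pow, ← map_pow, pow_orderOf_eq_one, map_one, map_one]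
  have h2 : |D (ρ g)| = 1 := by
    have h3 : |D (ρ g)| ^ orderOf g = 1 := by rw [← abs_pow, h1, abs_one]
    exact (pow_eq_one_iff_of_nonneg (abs_nonneg _) (orderOf_pos g).ne').1 h3
  have h0 : D (ρ g) ≠ 0 := by
    intro h
    rw [h, abs_zero] at h2
    exact zero_ne_one h2
  refine ⟨(ρ g).continuous.measurable, ?_⟩
  have h4 := Measure.map_linearMap_addHaar_eq_smul_addHaar
    (volume : Measure (Eucl d)) (f := (ρ g : Eucl d →ₗ[ℝ] Eucl d)) h0
  have h5 : |(LinearMap.det (ρ g : Eucl d →ₗ[ℝ] Eucl d))⁻¹| = 1 := by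
    rw [abs_inv]
    exact inv_eq_one.2 h2
  rw [h5, ENNReal.ofReal_one, one_smul] at h4
  exact h4

/-- The translation `t_k f (x) = f (x - k)` on `L²(ℝ^d)`, for `k ∈ ℤ^d`. -/
def shiftOp {d : ℕ} (k : Fin d → ℤ) : L2 d →ₗᵢ[ℂ] L2 d :=
  Lp.compMeasurePreservingₗᵢ ℂ (fun x => x - intVec k)
    (measurePreserving_sub_right volume (intVec k))

/-- The action `R_g f (x) = f (g⁻¹ x)` on `L²(ℝ^d)`. -/
def rotOp {d : ℕ} {G : Type*} [Group G] [Finite G]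
    (ρ : G →* (Eucl d ≃L[ℝ] Eucl d)) (g : G) : L2 d →ₗᵢ[ℂ] L2 d :=
  Lp.compMeasurePreservingₗᵢ ℂ (ρ g⁻¹) (measurePreserving_of_finite ρ g⁻¹)

/-- `S_Γ(Φ)`: the closed linear span of all `t_k R_g φ_i`, for `Γ = ℤ^d ⋊ G`. -/
def gammaSpan {d : ℕ} {G : Type*} [Group G] [Finite G]
    (ρ : G →* (Eucl d ≃L[ℝ] Eucl d)) {n : ℕ} (Φ : Fin n → L2 d) : Submodule ℂ (L2 d) :=
  (Submodule.span ℂ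
    {h : L2 d | ∃ (k : Fin d → ℤ) (g : G) (i : Fin n),
      h = shiftOp k (rotOp ρ g (Φ i))}).topologicalClosure

instance gammaSpan_hasOrthogonalProjection {d : ℕ} {G : Type*} [Group G] [Finite G]
    (ρ : G →* (Eucl d ≃L[ℝ] Eucl d)) {n : ℕ} (Φ : Fin n → L2 d) :
    (gammaSpan ρ Φ).HasOrthogonalProjection := by
  unfold gammaSpan
  infer_instance

/-- Invariance of a subspace of `L²(ℝ^d)` under `Γ = ℤ^d ⋊ G`, where `(k, g)` acts by `t_k R_g`. -/
def IsGammaInvariant {d : ℕ} {G : Type*} [Group G] [Finite G]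
    (ρ : G →* (Eucl d ≃L[ℝ] Eucl d)) (S : Submodule ℂ (L2 d)) : Prop :=
  ∀ (k : Fin d → ℤ) (g : G), ∀ f ∈ S, shiftOp k (rotOp ρ g f) ∈ S

/-- The length of a `Γ`-invariant subspace: the minimal number of generators
(`⊤` if it is not finitely generated). -/
def gammaLength {d : ℕ} {G : Type*} [Group G] [Finite G]
    (ρ : G →* (Eucl d ≃L[ℝ] Eucl d)) (S : Submodule ℂ (L2 d)) : ℕ∞ :=
  ⨅ (n : ℕ) (_ : ∃ Φ : Fin n → L2 d, gammaSpan ρ Φ = S), (n : ℕ∞)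

/-- The Paley-Wiener space `PW_Ω` of all `f ∈ L²(ℝ^d)` whose Fourier transform vanishes
(almost everywhere) off `Ω`. -/
def paleyWiener {d : ℕ} (Ω : Set (Eucl d)) : Submodule ℂ (L2 d) where
  carrier := {f | ∀ᵐ ω : Eucl d, ω ∉ Ω → (𝓕 f : L2 d) ω = 0}
  zero_mem' := by
    have h : (𝓕 (0 : L2 d) : L2 d) = 0 := map_zero (Lp.fourierTransformₗᵢ (Eucl d) ℂ)
    simp only [Set.mem_ofPred_eq, h]
    exact Filter.Eventually.of_forall fun ω _ => by simp
  add_mem' := by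
    intro f g hf hg
    have h : (𝓕 (f + g) : L2 d) = 𝓕 f + 𝓕 g := map_add (Lp.fourierTransformₗᵢ (Eucl d) ℂ) f g
    simp only [Set.mem_ofPred_eq, h] at hf hg ⊢
    filter_upwards [hf, hg, Lp.coeFn_add (𝓕 f : L2 d) (𝓕 g : L2 d)] with ω h1 h2 h3 hω
    rw [h3, Pi.add_apply, h1 hω, h2 hω, add_zero]
  smul_mem' := by
    intro c f hf
    have h : (𝓕 (c • f) : L2 d) = c • 𝓕 f := map_smul (Lp.fourierTransformₗᵢ (Eucl d) ℂ) c f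
    simp only [Set.mem_ofPred_eq, h] at hf ⊢
    filter_upwards [hf, Lp.coeFn_smul c (𝓕 f : L2 d)] with ω h1 h3 hω
    rw [h3, Pi.smul_apply, h1 hω, smul_zero]

/-- The class `C_ℓ(Ω)` of closed `Γ`-invariant subspaces of `L²(ℝ^d)` that have length at most `ℓ`
and are contained in `PW_Ω`. -/
def gammaClass {d : ℕ} {G : Type*} [Group G] [Finite G]
    (ρ : G →* (Eucl d ≃L[ℝ] Eucl d)) (ℓ : ℕ) (Ω : Set (Eucl d)) : Set (Submodule ℂ (L2 d)) :=
  {S | IsClosed (S : Set (L2 d)) ∧ IsGammaInvariant ρ S ∧ gammaLength ρ S ≤ ℓ ∧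
    S ≤ paleyWiener Ω}

/-- The error `E(F, S) = ∑ i, ‖f_i - P_S f_i‖²`, with `P_S` the orthogonal projection onto `S`. -/
def approxError {d m : ℕ} (F : Fin m → L2 d) (S : Submodule ℂ (L2 d))
    [S.HasOrthogonalProjection] : ℝ :=
  ∑ i, ‖F i - S.starProjection (F i)‖ ^ 2

/-- Invariance of a set `Ω` of frequencies under the action of `G` on the frequency space, which is
the action dual to that on `ℝ^d`: the element `g` acts by the transpose of `ρ g⁻¹`, so that
`⟨g x, g ω⟩ = ⟨x, ω⟩`. If `ρ g` is orthogonal, this transpose is `ρ g` itself. -/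
def IsFrequencyInvariant {d : ℕ} {G : Type*} [Group G]
    (ρ : G →* (Eucl d ≃L[ℝ] Eucl d)) (Ω : Set (Eucl d)) : Prop :=
  ∀ g : G, ContinuousLinearMap.adjoint (ρ g⁻¹ : Eucl d →L[ℝ] Eucl d) '' Ω = Ω

end

/-! On the Fourier side, cut a function into its fibers `(f̂(ω + k))_k` in `ℓ²(ℤ^d)`, for `ω` in the
unit cube. A translation multiplies each fiber by a scalar. Hence closed translation invariant
spaces are modules over the periodic functions (`mem_of_fourier_eq_sum`), and over almost every `ω`
the fibers of the orbit span of `Ψ` lie in the span of the fibers of the `R_g ψ_i`, of dimension at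
most `ℓ|G|` (`ae_fiber_mem_span`).

`G` acts on the frequencies modulo `ℤ^d`, almost everywhere freely since the action is faithful, so
there is a measurable periodic fundamental domain `D` (`exists_frequencyDomain`). The squared error
is the integral over `D` in the cube of the squared errors for the `m|G|` fibers of the `R_g f_i`
(`sum_enorm_sq_eq_lintegral_fiber`). Over each `ω` this is an Eckart–Young problem: approximate
finitely many vectors from a subspace of dimension `ℓ|G|`. Its solution depends measurably on the
Gram matrix (`exists_measurable_optimal_approximation`), and integrating the optimum bounds the
error of every `Ψ` from below.

The bound is attained. The optimal subspaces are spanned over `D` by `ℓ|G|` functions `y_(i,g)`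
supported in `D`. As the images of `D` under `G` are disjoint, `φ_i = ∑_g R_g⁻¹ y_(i,g)` packs `|G|`
of them into one generator: on `D`, `R_g φ_i` agrees with `y_(i,g)` in frequency, and multiplication
by the periodic indicator of `D` recovers `y_(i,g)`.

To stay inside `PW_Ω`, the data are projected there first, which changes all competing errors by the
same constant (`approxError_eq_of_le`). The optimal fibers are combinations of fibers of the data,
so they vanish off `Ω` too. -/

noncomputable section

open Filter Topology

/-! ### The action of `Γ` on the Fourier side -/

/-- The lattice character `ω ↦ exp (-2πi ⟨k, ω⟩)`. -/
def latChar {d : ℕ} (k : Fin d → ℤ) (ω : Eucl d) : ℂ :=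
  Complex.exp ((-2 * Real.pi * inner ℝ (intVec k) ω : ℝ) * Complex.I)

theorem inner_intVec_intVec {d : ℕ} (k l : Fin d → ℤ) :
    inner ℝ (intVec k) (intVec l) = ((∑ i, l i * k i : ℤ) : ℝ) := by
  simp [intVec, PiLp.inner_apply]

/-- Inner products of lattice vectors are integers. This periodicity makes a translation act as a
scalar on each fiber. -/
theorem latChar_add_intVec {d : ℕ} (k l : Fin d → ℤ) (ω : Eucl d) :
    latChar k (ω + intVec l) = latChar k ω := by
  unfold latChar
  rw [inner_add_right, inner_intVec_intVec]
  rw [Complex.exp_eq_exp_iff_exists_int]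
  refine ⟨-(∑ i, l i * k i), ?_⟩
  push_cast
  ring

/-- A graph of multiplication by a fixed function is closed in `L² × L²`. -/
theorem isClosed_setOf_ae_eq_mul {α : Type*} [MeasurableSpace α] {μ : Measure α} (c : α → ℂ) :
    IsClosed {p : Lp ℂ 2 μ × Lp ℂ 2 μ | ∀ᵐ ω ∂μ, p.2 ω = c ω * p.1 ω} := by
  refine IsSeqClosed.isClosed fun u p hu hup => ?_
  have h1 : Tendsto (fun n => (u n).1) atTop (𝓝 p.1) := (continuous_fst.tendsto p).comp hup
  have h2 : Tendsto (fun n => (u n).2) atTop (𝓝 p.2) := (continuous_snd.tendsto p).comp hup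
  obtain ⟨a, ha, ha'⟩ := (tendstoInMeasure_of_tendsto_Lp h1).exists_seq_tendsto_ae
  obtain ⟨b, hb, hb'⟩ :=
    (tendstoInMeasure_of_tendsto_Lp (h2.comp ha.tendsto_atTop)).exists_seq_tendsto_ae
  have hu' : ∀ᵐ ω ∂μ, ∀ n, (u n).2 ω = c ω * (u n).1 ω := ae_all_iff.2 hu
  filter_upwards [ha', hb', hu'] with ω h3 h4 h5
  refine tendsto_nhds_unique h4 ?_
  have h6 := (h3.comp hb.tendsto_atTop).const_mul (c ω)
  refine h6.congr fun n => ?_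
  simp [h5]

theorem coeFn_shiftOp {d : ℕ} (k : Fin d → ℤ) (f : L2 d) :
    shiftOp k f =ᵐ[volume] fun x => f (x - intVec k) :=
  Lp.coeFn_compMeasurePreserving f (measurePreserving_sub_right volume (intVec k))

theorem coeFn_rotOp {d : ℕ} {G : Type*} [Group G] [Finite G]
    (ρ : G →* (Eucl d ≃L[ℝ] Eucl d)) (g : G) (f : L2 d) :
    rotOp ρ g f =ᵐ[volume] fun x => f (ρ g⁻¹ x) :=
  Lp.coeFn_compMeasurePreserving f (measurePreserving_of_finite ρ g⁻¹)

theorem fourier_comp_sub_intVec {d : ℕ} (k : Fin d → ℤ) (f : Eucl d → ℂ) (ω : Eucl d) :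
    𝓕 (fun x => f (x - intVec k)) ω = latChar k ω * 𝓕 f ω := by
  rw [Real.fourier_eq', Real.fourier_eq', ← integral_add_right_eq_self _ (intVec k),
    ← integral_const_mul]
  congr 1 with x
  simp only [latChar, add_sub_cancel_right, smul_eq_mul, ← mul_assoc, ← Complex.exp_add]
  congr 2
  rw [inner_add_left]
  push_cast
  ring

/-- The Fourier transform intertwines the translation by `k` with the multiplication by
`latChar k`. -/
theorem fourier_shiftOp {d : ℕ} (k : Fin d → ℤ) (f : L2 d) :
    ∀ᵐ ω, (𝓕 (shiftOp k f) : L2 d) ω = latChar k ω * (𝓕 f : L2 d) ω := by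
  -- The relation is closed in `f`, so density reduces it to Schwartz functions, where the transform
  -- is an integral.
  have hc : IsClosed {f : L2 d |
      ∀ᵐ ω, (𝓕 (shiftOp k f) : L2 d) ω = latChar k ω * (𝓕 f : L2 d) ω} := by
    have h : Continuous fun f : L2 d => ((𝓕 f : L2 d), (𝓕 (shiftOp k f) : L2 d)) :=
      (Lp.fourierTransformₗᵢ (Eucl d) ℂ).continuous.prodMk
        ((Lp.fourierTransformₗᵢ (Eucl d) ℂ).continuous.comp (shiftOp k).continuous)
    exact (isClosed_setOf_ae_eq_mul (latChar k)).preimage h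
  refine (SchwartzMap.denseRange_toLpCLM (E := Eucl d) (F := ℂ) (p := 2) (μ := volume)
    ENNReal.ofNat_ne_top).induction_on (p := fun f : L2 d =>
      ∀ᵐ ω, (𝓕 (shiftOp k f) : L2 d) ω = latChar k ω * (𝓕 f : L2 d) ω) f hc fun s => ?_
  have h1 : shiftOp k (SchwartzMap.toLpCLM ℝ ℂ 2 volume s)
      = (s.compSubConstCLM ℂ (intVec k)).toLp 2 volume := by
    apply Lp.ext
    filter_upwards [coeFn_shiftOp k (s.toLp 2 volume),
      (s.compSubConstCLM ℂ (intVec k)).coeFn_toLp 2 volume,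
      (measurePreserving_sub_right volume (intVec k)).quasiMeasurePreserving.ae
        (s.coeFn_toLp 2 volume)] with x h1 h2 h3
    rw [h2, SchwartzMap.toLpCLM_apply, h1, h3]
    rfl
  rw [h1, SchwartzMap.toLpCLM_apply, SchwartzMap.toLp_fourier_eq, SchwartzMap.toLp_fourier_eq]
  filter_upwards [(𝓕 s).coeFn_toLp 2 volume,
    (𝓕 (s.compSubConstCLM ℂ (intVec k))).coeFn_toLp 2 volume] with ω h2 h3
  rw [h2, h3, SchwartzMap.fourier_coe, SchwartzMap.fourier_coe, ← fourier_comp_sub_intVec]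
  rfl

/-- The action of `g` on the frequency space. -/
def freqAct {d : ℕ} {G : Type*} [Group G]
    (ρ : G →* (Eucl d ≃L[ℝ] Eucl d)) (g : G) : Eucl d →L[ℝ] Eucl d :=
  ContinuousLinearMap.adjoint (ρ g⁻¹ : Eucl d →L[ℝ] Eucl d)

section FreqAct

variable {d : ℕ} {G : Type*} [Group G] (ρ : G →* (Eucl d ≃L[ℝ] Eucl d))

theorem freqAct_one (ω : Eucl d) : freqAct ρ 1 ω = ω := by
  refine ext_inner_left ℝ fun v => ?_
  simp [freqAct, ContinuousLinearMap.adjoint_inner_right]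

theorem freqAct_mul (g h : G) (ω : Eucl d) :
    freqAct ρ (g * h) ω = freqAct ρ g (freqAct ρ h ω) := by
  refine ext_inner_left ℝ fun v => ?_
  simp [freqAct, ContinuousLinearMap.adjoint_inner_right]

theorem inner_freqAct (g : G) (x ω : Eucl d) :
    inner ℝ (ρ g x) (freqAct ρ g ω) = inner ℝ x ω := by
  rw [freqAct, ContinuousLinearMap.adjoint_inner_right]
  congr 1
  rw [map_inv]
  exact (ρ g).symm_apply_apply x

/-- The frequency action as a homomorphism. -/
def freqHom : G →* (Eucl d ≃L[ℝ] Eucl d) where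
  toFun g := ContinuousLinearEquiv.equivOfInverse (freqAct ρ g) (freqAct ρ g⁻¹)
    (fun x => by rw [← freqAct_mul, inv_mul_cancel, freqAct_one])
    (fun x => by rw [← freqAct_mul, mul_inv_cancel, freqAct_one])
  map_one' := by
    refine ContinuousLinearEquiv.ext (funext fun x => ?_)
    change freqAct ρ 1 x = x
    exact freqAct_one ρ x
  map_mul' g h := by
    refine ContinuousLinearEquiv.ext (funext fun x => ?_)
    change freqAct ρ (g * h) x = freqAct ρ g (freqAct ρ h x)
    exact freqAct_mul ρ g h x

theorem measurePreserving_freqAct [Finite G] (g : G) :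
    MeasurePreserving (freqAct ρ g) (volume : Measure (Eucl d)) volume :=
  measurePreserving_of_finite (freqHom ρ) g

theorem fourier_comp_act [Finite G] (g : G) (f : Eucl d → ℂ) (ω : Eucl d) :
    𝓕 (fun x => f (ρ g⁻¹ x)) ω = 𝓕 f (freqAct ρ g⁻¹ ω) := by
  rw [Real.fourier_eq', Real.fourier_eq', ← (measurePreserving_of_finite ρ g⁻¹).integral_comp
    (ρ g⁻¹).toHomeomorph.measurableEmbedding
    fun x => Complex.exp (↑(-2 * Real.pi * inner ℝ x (freqAct ρ g⁻¹ ω)) * Complex.I) • f x]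
  simp only [inner_freqAct]

/-- The Fourier transform intertwines `R_g` with the action of `g` on the frequencies. -/
theorem fourier_rotOp [Finite G] (g : G) (f : L2 d) :
    ∀ᵐ ω, (𝓕 (rotOp ρ g f) : L2 d) ω = (𝓕 f : L2 d) (freqAct ρ g⁻¹ ω) := by
  set T : L2 d →ₗᵢ[ℂ] L2 d := Lp.compMeasurePreservingₗᵢ ℂ (freqAct ρ g⁻¹)
    (measurePreserving_freqAct ρ g⁻¹) with hT
  have hTc : ∀ f : L2 d, T f =ᵐ[volume] fun ω => f (freqAct ρ g⁻¹ ω) := fun f =>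
    Lp.coeFn_compMeasurePreserving f (measurePreserving_freqAct ρ g⁻¹)
  suffices h : (𝓕 (rotOp ρ g f) : L2 d) = T (𝓕 f) by
    rw [h]
    exact hTc _
  refine (SchwartzMap.denseRange_toLpCLM (E := Eucl d) (F := ℂ) (p := 2) (μ := volume)
    ENNReal.ofNat_ne_top).induction_on (p := fun f : L2 d =>
      (𝓕 (rotOp ρ g f) : L2 d) = T (𝓕 f)) f ?_ fun s => ?_
  · exact isClosed_eq
      ((Lp.fourierTransformₗᵢ (Eucl d) ℂ).continuous.comp (rotOp ρ g).continuous)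
      (T.continuous.comp (Lp.fourierTransformₗᵢ (Eucl d) ℂ).continuous)
  have h1 : rotOp ρ g (SchwartzMap.toLpCLM ℝ ℂ 2 volume s)
      = (SchwartzMap.compCLMOfContinuousLinearEquiv ℂ (ρ g⁻¹) s).toLp 2 volume := by
    apply Lp.ext
    filter_upwards [coeFn_rotOp ρ g (s.toLp 2 volume),
      (SchwartzMap.compCLMOfContinuousLinearEquiv ℂ (ρ g⁻¹) s).coeFn_toLp 2 volume,
      (measurePreserving_of_finite ρ g⁻¹).quasiMeasurePreserving.ae
        (s.coeFn_toLp 2 volume)] with x h1 h2 h3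
    rw [h2, SchwartzMap.toLpCLM_apply, h1, h3]
    rfl
  rw [h1, SchwartzMap.toLpCLM_apply, SchwartzMap.toLp_fourier_eq, SchwartzMap.toLp_fourier_eq]
  apply Lp.ext
  filter_upwards [hTc ((𝓕 s).toLp 2 volume), (measurePreserving_freqAct ρ g⁻¹).quasiMeasurePreserving.ae
      ((𝓕 s).coeFn_toLp 2 volume),
    (𝓕 (SchwartzMap.compCLMOfContinuousLinearEquiv ℂ (ρ g⁻¹) s)).coeFn_toLp 2 volume]
    with ω h2 h3 h4
  rw [h2, h3, h4, SchwartzMap.fourier_coe, SchwartzMap.fourier_coe, ← fourier_comp_act]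
  rfl

end FreqAct

/-! ### Periodization over the unit cube -/

/-- The unit cube `(0, 1]^d`. -/
def unitCube (d : ℕ) : Set (Eucl d) := {ω | ∀ i, ω i ∈ Set.Ioc (0 : ℝ) 1}

theorem measurableSet_unitCube (d : ℕ) : MeasurableSet (unitCube d) := by
  have : unitCube d = ⋂ i, (fun ω : Eucl d => ω i) ⁻¹' Set.Ioc (0 : ℝ) 1 := by
    ext; simp [unitCube]
  rw [this]
  exact MeasurableSet.iInter fun i => measurableSet_Ioc.preimage (by fun_prop)

/-- Lebesgue measure on the unit cube. -/
abbrev cubeMeasure (d : ℕ) : Measure (Eucl d) := volume.restrict (unitCube d)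

theorem intVec_apply {d : ℕ} (k : Fin d → ℤ) (i : Fin d) : intVec k i = k i := rfl

theorem intVec_add {d : ℕ} (k l : Fin d → ℤ) : intVec (k + l) = intVec k + intVec l := by
  ext i; simp [intVec_apply]

/-- The integer vector that moves `ω` into the unit cube. -/
def cubeIndex {d : ℕ} (ω : Eucl d) : Fin d → ℤ := fun i => ⌈ω i⌉ - 1

theorem sub_intVec_mem_unitCube {d : ℕ} (k : Fin d → ℤ) (ω : Eucl d) :
    ω - intVec k ∈ unitCube d ↔ k = cubeIndex ω := by
  have : ∀ i, (ω - intVec k) i ∈ Set.Ioc (0 : ℝ) 1 ↔ k i = cubeIndex ω i := by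
    intro i
    rw [PiLp.sub_apply, intVec_apply, cubeIndex, Set.mem_Ioc, eq_sub_iff_add_eq, eq_comm,
      Int.ceil_eq_iff]
    push_cast
    constructor <;> rintro ⟨h1, h2⟩ <;> constructor <;> linarith
  simp only [unitCube, Set.mem_ofPred_eq, this, funext_iff]

/-- The half-open cube is tiled exactly: each point has one lattice translate in it, given by
`cubeIndex`. -/
theorem lintegral_eq_lintegral_cube {d : ℕ} (f : Eucl d → ENNReal) (hf : AEMeasurable f) :
    ∫⁻ ω, f ω = ∫⁻ ω, ∑' k, f (ω + intVec k) ∂cubeMeasure d := by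
  have hT : ∀ k : Fin d → ℤ, (fun ω : Eucl d => ω - intVec k) ⁻¹' unitCube d
      = {ω | k = cubeIndex ω} := fun k => Set.ext fun ω => sub_intVec_mem_unitCube k ω
  have hmeas : ∀ k : Fin d → ℤ, MeasurableSet {ω : Eucl d | k = cubeIndex ω} := fun k =>
    hT k ▸ (measurableSet_unitCube d).preimage (measurable_id.sub_const _)
  have hU : (⋃ k : Fin d → ℤ, {ω : Eucl d | k = cubeIndex ω}) = Set.univ := by
    ext; simp
  have hD : Pairwise (Function.onFun Disjoint fun k : Fin d → ℤ =>
      {ω : Eucl d | k = cubeIndex ω}) := by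
    intro k l hkl
    exact Set.disjoint_left.2 fun ω (h1 : k = _) (h2 : l = _) => hkl (h1.trans h2.symm)
  have hq : ∀ k : Fin d → ℤ, MeasurePreserving (fun ω : Eucl d => ω + intVec k) := fun k =>
    measurePreserving_add_right volume (intVec k)
  rw [lintegral_tsum]
  · rw [← setLIntegral_univ, ← hU, lintegral_iUnion hmeas hD]
    congr 1 with k
    have h := (hq k).setLIntegral_comp_preimage_emb
      (MeasurableEquiv.addRight (intVec k)).measurableEmbedding f {ω | k = cubeIndex ω}
    rw [← h, ← hT k]
    congr 2
    ext ω
    simp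
  · intro k
    exact (hf.comp_quasiMeasurePreserving (hq k).quasiMeasurePreserving).restrict

theorem ae_cube_of_ae {d : ℕ} {p : Eucl d → Prop} (h : ∀ᵐ ω, p ω) :
    ∀ᵐ ω ∂cubeMeasure d, ∀ k, p (ω + intVec k) := by
  refine ae_restrict_of_ae (ae_all_iff.2 fun k => ?_)
  exact (measurePreserving_add_right volume (intVec k)).quasiMeasurePreserving.ae h

/-! ### Uniqueness of Fourier coefficients -/

/-- Characters span a dense subspace of the continuous functions, so the functional `φ ↦ ∫ φ f`
vanishes; continuous approximations of indicators then kill the integrals of `f` over closed sets.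
Since `μ` is arbitrary, the cube measure pulled back to the torus need not be identified with Haar
measure. -/
theorem ae_eq_zero_of_forall_integral_mFourier_eq_zero {ι : Type*} [Fintype ι]
    {μ : Measure (UnitAddTorus ι)} {f : UnitAddTorus ι → ℂ} (hf : Integrable f μ)
    (h : ∀ n, ∫ t, UnitAddTorus.mFourier n t * f t ∂μ = 0) : f =ᵐ[μ] 0 := by
  let T : C(UnitAddTorus ι, ℂ) →L[ℂ] ℂ := LinearMap.mkContinuous
    { toFun := fun φ => ∫ t, φ t * f t ∂μ
      map_add' := fun φ ψ => by
        simp only [ContinuousMap.add_apply, add_mul]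
        exact integral_add (hf.bdd_mul φ.continuous.aestronglyMeasurable
            (Eventually.of_forall fun t => φ.norm_coe_le_norm t))
          (hf.bdd_mul ψ.continuous.aestronglyMeasurable
            (Eventually.of_forall fun t => ψ.norm_coe_le_norm t))
      map_smul' := fun c φ => by
        simp only [ContinuousMap.smul_apply, smul_eq_mul, mul_assoc, integral_const_mul,
          RingHom.id_apply] }
    (∫ t, ‖f t‖ ∂μ) (fun φ => by
      refine (norm_integral_le_integral_norm _).trans ?_
      rw [mul_comm, ← integral_const_mul]
      refine integral_mono_of_nonneg (Eventually.of_forall fun t => norm_nonneg _)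
        (hf.norm.const_mul _) (Eventually.of_forall fun t => ?_)
      simp only [norm_mul]
      gcongr
      exact φ.norm_coe_le_norm t)
  have hT : T = 0 := by
    have hker : (⊤ : Submodule ℂ C(UnitAddTorus ι, ℂ)) ≤ T.ker := by
      rw [← UnitAddTorus.span_mFourier_closure_eq_top]
      refine Submodule.topologicalClosure_minimal _ (Submodule.span_le.2 ?_) T.isClosed_ker
      rintro _ ⟨n, rfl⟩
      exact LinearMap.mem_ker.2 (h n)
    ext φ
    exact hker (Submodule.mem_top : φ ∈ _)
  refine ae_eq_zero_of_forall_setIntegral_isClosed_eq_zero hf fun s hs => ?_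
  have h0 : ∀ n, ∫ t, ((hs.apprSeq n t : ℝ) : ℂ) * f t ∂μ = 0 := fun n => by
    have := DFunLike.congr_fun hT ⟨fun t => ((hs.apprSeq n t : ℝ) : ℂ), by fun_prop⟩
    exact this
  have hlim : Tendsto (fun n => ∫ t, ((hs.apprSeq n t : ℝ) : ℂ) * f t ∂μ) atTop
      (𝓝 (∫ t, s.indicator f t ∂μ)) := by
    refine tendsto_integral_of_dominated_convergence (fun t => ‖f t‖) (fun n => ?_) hf.norm
      (fun n => Eventually.of_forall fun t => ?_) (Eventually.of_forall fun t => ?_)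
    · exact (Continuous.aestronglyMeasurable (by fun_prop)).mul hf.aestronglyMeasurable
    · rw [norm_mul]
      refine mul_le_of_le_one_left (norm_nonneg _) ?_
      simpa using HasOuterApproxClosed.apprSeq_apply_le_one hs n t
    · have h1 := tendsto_pi_nhds.1 (HasOuterApproxClosed.tendsto_apprSeq hs) t
      have h2 : Tendsto (fun n => ((hs.apprSeq n t : ℝ) : ℂ)) atTop
          (𝓝 (((s.indicator (fun _ => (1 : NNReal)) t : NNReal) : ℝ) : ℂ)) :=
        (Complex.continuous_ofReal.tendsto _).comp ((NNReal.continuous_coe.tendsto _).comp h1)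
      convert h2.mul_const (f t) using 2
      by_cases ht : t ∈ s <;> simp [ht]
  rw [← integral_indicator hs.measurableSet]
  simp only [h0] at hlim
  exact tendsto_nhds_unique hlim tendsto_const_nhds

/-- The section of the quotient map onto the torus with values in the unit cube. -/
def torusSection {d : ℕ} (t : UnitAddTorus (Fin d)) : Eucl d :=
  WithLp.toLp 2 (UnitAddTorus.measurableEquivPiIoc (fun _ : Fin d => (0 : ℝ)) t).1

theorem coe_torusSection {d : ℕ} (t : UnitAddTorus (Fin d)) (i : Fin d) :
    ((torusSection t i : ℝ) : UnitAddCircle) = t i :=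
  congrFun ((UnitAddTorus.measurableEquivPiIoc (fun _ : Fin d => (0 : ℝ))).symm_apply_apply t) i

theorem measurableEmbedding_torusSection {d : ℕ} :
    MeasurableEmbedding (torusSection (d := d)) :=
  (MeasurableEquiv.toLp 2 (Fin d → ℝ)).measurableEmbedding.comp
    ((MeasurableEmbedding.subtype_coe
      (MeasurableSet.univ_pi' (fun _ => measurableSet_Ioc))).comp
        (UnitAddTorus.measurableEquivPiIoc (fun _ : Fin d => (0 : ℝ))).measurableEmbedding)

theorem range_torusSection {d : ℕ} : Set.range (torusSection (d := d)) = unitCube d := by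
  ext ω
  constructor
  · rintro ⟨t, rfl⟩ i
    simpa [torusSection] using (UnitAddTorus.measurableEquivPiIoc (fun _ : Fin d => (0 : ℝ)) t).2 i
  · intro h
    refine ⟨(UnitAddTorus.measurableEquivPiIoc (fun _ : Fin d => (0 : ℝ))).symm
      ⟨fun i => ω i, fun i => by simpa using h i⟩, ?_⟩
    rw [torusSection, MeasurableEquiv.apply_symm_apply]

theorem measurePreserving_torusSection {d : ℕ} :
    MeasurePreserving (torusSection (d := d)) ((cubeMeasure d).comap torusSection)
      (cubeMeasure d) :=
  ⟨measurableEmbedding_torusSection.measurable, by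
    rw [measurableEmbedding_torusSection.map_comap, range_torusSection,
      Measure.restrict_restrict (measurableSet_unitCube d), Set.inter_self]⟩

theorem mFourier_eq_latChar_torusSection {d : ℕ} (k : Fin d → ℤ) (t : UnitAddTorus (Fin d)) :
    UnitAddTorus.mFourier (-k) t = latChar k (torusSection t) := by
  have h : UnitAddTorus.mFourier (-k) t
      = ∏ i, fourier ((-k) i) ((torusSection t i : ℝ) : UnitAddCircle) := by
    simp only [coe_torusSection]
    rfl
  rw [h, latChar, PiLp.inner_apply]
  simp only [fourier_coe_apply, ← Complex.exp_sum]
  congr 1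
  push_cast
  rw [Finset.mul_sum, Finset.sum_mul]
  refine Finset.sum_congr rfl fun i _ => ?_
  simp [intVec_apply]
  ring

theorem ae_cube_eq_zero_of_forall_integral_latChar {d : ℕ} {W : Eucl d → ℂ}
    (hW : Integrable W (cubeMeasure d))
    (h : ∀ k, ∫ ω, latChar k ω * W ω ∂cubeMeasure d = 0) :
    ∀ᵐ ω ∂cubeMeasure d, W ω = 0 := by
  have hmp := measurePreserving_torusSection (d := d)
  have hme := measurableEmbedding_torusSection (d := d)
  rw [← hmp.map_eq, hme.ae_map_iff]
  refine ae_eq_zero_of_forall_integral_mFourier_eq_zero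
    ((hmp.integrable_comp_emb hme).2 hW) fun n => ?_
  rw [← h (-n), ← hmp.integral_comp hme]
  simp only [← mFourier_eq_latChar_torusSection, neg_neg]

/-! ### Fibers over the unit cube -/

section Fibers

variable {d : ℕ}

/-- With `ℝ^d` seen as cube times lattice, sums over the lattice become integrals and Fubini
applies. -/
theorem measurePreserving_add_intVec :
    MeasurePreserving (fun p : Eucl d × (Fin d → ℤ) => p.1 + intVec p.2)
      ((cubeMeasure d).prod Measure.count) volume := by
  have hm : Measurable (fun p : Eucl d × (Fin d → ℤ) => p.1 + intVec p.2) :=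
    measurable_fst.add ((measurable_of_countable intVec).comp measurable_snd)
  refine ⟨hm, Measure.ext fun s hs => ?_⟩
  rw [Measure.map_apply hm hs, ← lintegral_indicator_one (hm hs), ← lintegral_indicator_one hs,
    lintegral_eq_lintegral_cube _ ((measurable_one.indicator hs).aemeasurable),
    lintegral_prod _ ((measurable_one.indicator (hm hs)).aemeasurable)]
  simp only [lintegral_count]
  rfl

theorem integrable_tsum_cube {F : Eucl d → ℂ} (hF : Integrable F) :
    Integrable (fun ω => ∑' k, F (ω + intVec k)) (cubeMeasure d) ∧
      ∫ ω, ∑' k, F (ω + intVec k) ∂cubeMeasure d = ∫ ω, F ω := by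
  have hmp := measurePreserving_add_intVec (d := d)
  have h1 : Integrable (fun p : Eucl d × (Fin d → ℤ) => F (p.1 + intVec p.2))
      ((cubeMeasure d).prod Measure.count) := hmp.integrable_comp_of_integrable hF
  have h2 : ∀ᵐ ω ∂cubeMeasure d, ∫ k, F (ω + intVec k) ∂Measure.count
      = ∑' k, F (ω + intVec k) := by
    filter_upwards [h1.prod_right_ae] with ω hω
    rw [integral_countable hω]
    simp [Measure.real]
  refine ⟨h1.integral_prod_left.congr h2, ?_⟩
  rw [← integral_congr_ae h2, ← integral_prod _ h1, ← hmp.map_eq,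
    integral_map hmp.measurable.aemeasurable (hmp.map_eq.symm ▸ hF.aestronglyMeasurable)]

/-- Square summable sequences on the lattice. -/
abbrev FiberSpace (d : ℕ) : Type := lp (fun _ : Fin d → ℤ => ℂ) 2

open Classical in
/-- The fiber `(f (ω + k))_k` of `f` over `ω`, or zero if it is not square summable. -/
def fiber (f : Eucl d → ℂ) (ω : Eucl d) : FiberSpace d :=
  if h : Memℓp (fun k => f (ω + intVec k)) 2 then ⟨_, h⟩ else 0

theorem coe_fiber {f : Eucl d → ℂ} {ω : Eucl d} (h : Memℓp (fun k => f (ω + intVec k)) 2)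
    (k : Fin d → ℤ) : fiber f ω k = f (ω + intVec k) := by
  rw [fiber, dif_pos h]

theorem memℓp_two_iff {ι : Type*} {u : ι → ℂ} : Memℓp u 2 ↔ ∑' k, ‖u k‖ₑ ^ 2 ≠ ⊤ := by
  rw [memℓp_gen_iff (by norm_num)]
  have : ∀ k, ‖u k‖ₑ ^ 2 = ((‖u k‖₊ ^ 2 : NNReal) : ENNReal) := fun k => by
    rw [ENNReal.coe_pow]; rfl
  simp only [this, ENNReal.tsum_coe_ne_top_iff_summable]
  rw [← NNReal.summable_coe]
  simp

theorem enorm_fiber_sq {f : Eucl d → ℂ} {ω : Eucl d}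
    (h : Memℓp (fun k => f (ω + intVec k)) 2) :
    ‖fiber f ω‖ₑ ^ 2 = ∑' k, ‖f (ω + intVec k)‖ₑ ^ 2 := by
  have h1 := lp.norm_rpow_eq_tsum (p := 2) (by norm_num) (fiber f ω)
  have h2 := (memℓp_gen_iff (p := 2) (by norm_num)).1 h
  simp only [ENNReal.toReal_ofNat, Real.rpow_two, coe_fiber h] at h1 h2
  rw [← ofReal_norm, ← ENNReal.ofReal_pow (norm_nonneg _), h1,
    ENNReal.ofReal_tsum_of_nonneg (fun _ => sq_nonneg _) h2]
  simp only [ENNReal.ofReal_pow (norm_nonneg _), ofReal_norm]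

theorem lintegral_enorm_sq_lt_top {α : Type*} [MeasurableSpace α] {μ : Measure α} {f : α → ℂ}
    (hf : MemLp f 2 μ) : ∫⁻ ω, ‖f ω‖ₑ ^ 2 ∂μ < ⊤ := by
  have := lintegral_rpow_enorm_lt_top_of_eLpNorm_lt_top (p := 2) (by norm_num) (by norm_num) hf.2
  simpa using this

theorem memLp_two_of_lintegral_lt_top {α : Type*} [MeasurableSpace α] {μ : Measure α} {f : α → ℂ}
    (hf : AEStronglyMeasurable f μ) (h : ∫⁻ ω, ‖f ω‖ₑ ^ 2 ∂μ < ⊤) : MemLp f 2 μ := by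
  refine ⟨hf, ?_⟩
  rw [eLpNorm_lt_top_iff_lintegral_rpow_enorm_lt_top (by norm_num) (by norm_num)]
  simpa using h

theorem ae_memℓp {f : Eucl d → ℂ} (hf : MemLp f 2) :
    ∀ᵐ ω ∂cubeMeasure d, Memℓp (fun k => f (ω + intVec k)) 2 := by
  have h1 : AEMeasurable fun ω => ‖f ω‖ₑ ^ 2 := hf.1.enorm.pow_const 2
  have h2 := lintegral_enorm_sq_lt_top hf
  rw [lintegral_eq_lintegral_cube _ h1] at h2
  have h3 : AEMeasurable (fun ω => ∑' k, ‖f (ω + intVec k)‖ₑ ^ 2) (cubeMeasure d) :=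
    AEMeasurable.tsum fun k => (h1.comp_quasiMeasurePreserving
      (measurePreserving_add_right volume (intVec k)).quasiMeasurePreserving).restrict
  filter_upwards [ae_lt_top' h3 h2.ne] with ω hω
  exact memℓp_two_iff.2 hω.ne

theorem lintegral_enorm_sq_eq_fiber {f : Eucl d → ℂ} (hf : MemLp f 2) :
    ∫⁻ ω, ‖f ω‖ₑ ^ 2 = ∫⁻ ω, ‖fiber f ω‖ₑ ^ 2 ∂cubeMeasure d := by
  rw [lintegral_eq_lintegral_cube _ (hf.1.enorm.pow_const 2)]
  refine lintegral_congr_ae ?_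
  filter_upwards [ae_memℓp hf] with ω hω
  rw [enorm_fiber_sq hω]

theorem sum_smul_apply {ι : Type*} [Fintype ι] (c : ι → ℂ) (v : ι → FiberSpace d)
    (k : Fin d → ℤ) : (∑ j, c j • v j : FiberSpace d) k = ∑ j, c j * v j k := by
  rw [lp.coeFn_sum, Finset.sum_apply]
  rfl

theorem memℓp_of_eq_sum {ι : Type*} [Fintype ι] {a : ι → Eucl d → ℂ} {ω : Eucl d}
    (ha : ∀ j, Memℓp (fun k => a j (ω + intVec k)) 2) {f : Eucl d → ℂ} {c : ι → ℂ}
    (hf : ∀ k, f (ω + intVec k) = ∑ j, c j * a j (ω + intVec k)) :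
    Memℓp (fun k => f (ω + intVec k)) 2 := by
  have h : (fun k => f (ω + intVec k)) = (∑ j, c j • fiber (a j) ω : FiberSpace d) := by
    funext k
    simp only [hf, sum_smul_apply, coe_fiber (ha _)]
  rw [h]
  exact lp.memℓp _

/-- The coefficients do not depend on `k`, so multiplication by periodic functions becomes a linear
combination of fibers. -/
theorem fiber_eq_sum {ι : Type*} [Fintype ι] {a : ι → Eucl d → ℂ} {ω : Eucl d}
    (ha : ∀ j, Memℓp (fun k => a j (ω + intVec k)) 2) {f : Eucl d → ℂ} {c : ι → ℂ}
    (hf : ∀ k, f (ω + intVec k) = ∑ j, c j * a j (ω + intVec k)) :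
    fiber f ω = ∑ j, c j • fiber (a j) ω := by
  ext k
  rw [coe_fiber (memℓp_of_eq_sum ha hf), hf]
  simp only [sum_smul_apply, coe_fiber (ha _)]

theorem fiber_congr {f h : Eucl d → ℂ} {ω : Eucl d}
    (hfh : ∀ k, f (ω + intVec k) = h (ω + intVec k)) : fiber f ω = fiber h ω := by
  have : (fun k => f (ω + intVec k)) = fun k => h (ω + intVec k) := funext hfh
  by_cases hf : Memℓp (fun k => f (ω + intVec k)) 2
  · ext k
    rw [coe_fiber hf, coe_fiber (this ▸ hf), hfh]
  · rw [fiber, fiber, dif_neg hf, dif_neg (this ▸ hf)]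

theorem inner_fiber {f h : Eucl d → ℂ} {ω : Eucl d}
    (hf : Memℓp (fun k => f (ω + intVec k)) 2) (hh : Memℓp (fun k => h (ω + intVec k)) 2) :
    inner ℂ (fiber f ω) (fiber h ω) = ∑' k, inner ℂ (f (ω + intVec k)) (h (ω + intVec k)) := by
  rw [lp.inner_eq_tsum]
  simp only [coe_fiber hf, coe_fiber hh]

theorem integrable_inner_fiber (f h : L2 d) :
    Integrable (fun ω => inner ℂ (fiber f ω) (fiber h ω)) (cubeMeasure d) ∧
      ∫ ω, inner ℂ (fiber f ω) (fiber h ω) ∂cubeMeasure d = inner ℂ f h := by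
  obtain ⟨h1, h2⟩ := integrable_tsum_cube (L2.integrable_inner f h (𝕜 := ℂ))
  have h3 : (fun ω => ∑' k, inner ℂ (f (ω + intVec k)) (h (ω + intVec k)))
      =ᵐ[cubeMeasure d] fun ω => inner ℂ (fiber f ω) (fiber h ω) := by
    filter_upwards [ae_memℓp (Lp.memLp f), ae_memℓp (Lp.memLp h)] with ω h4 h5
    rw [inner_fiber h4 h5]
  exact ⟨h1.congr h3, by rw [L2.inner_def, ← h2, integral_congr_ae h3]⟩

/-- A closed translation invariant subspace is a module over the periodic functions. -/
theorem mem_of_fourier_eq_sum {S : Submodule ℂ (L2 d)} (hS : IsClosed (S : Set (L2 d)))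
    (hinv : ∀ k, ∀ f ∈ S, shiftOp k f ∈ S) {ι : Type*} [Fintype ι] {w : ι → L2 d}
    (hw : ∀ j, w j ∈ S) {c : ι → Eucl d → ℂ} (hc : ∀ j ω k, c j (ω + intVec k) = c j ω)
    {x : L2 d} (hx : ∀ᵐ ω, (𝓕 x : L2 d) ω = ∑ j, c j ω * (𝓕 (w j) : L2 d) ω) : x ∈ S := by
  have : CompleteSpace S := hS.completeSpace_coe
  rw [← Submodule.orthogonal_orthogonal S, Submodule.mem_orthogonal]
  intro h hh
  rw [Submodule.mem_orthogonal'] at hh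
  -- The Fourier coefficients of this periodic function are the inner products of `h` with the
  -- translates of `w j`, all zero. Orthogonality thus holds fiber by fiber, and `c` may be
  -- unbounded.
  have h0 : ∀ j, ∀ᵐ ω ∂cubeMeasure d,
      inner ℂ (fiber (𝓕 h : L2 d) ω) (fiber (𝓕 (w j) : L2 d) ω) = 0 := by
    intro j
    refine ae_cube_eq_zero_of_forall_integral_latChar (integrable_inner_fiber _ _).1 fun k => ?_
    rw [← hh _ (hinv k _ (hw j)), ← Lp.inner_fourier_eq, ← (integrable_inner_fiber _ _).2]
    refine integral_congr_ae ?_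
    filter_upwards [ae_memℓp (Lp.memLp (𝓕 (w j) : L2 d)),
      ae_cube_of_ae (fourier_shiftOp k (w j))] with ω h1 h2
    rw [fiber_eq_sum (f := (𝓕 (shiftOp k (w j)) : L2 d)) (ι := Unit) (a := fun _ => (𝓕 (w j) : L2 d)) (c := fun _ => latChar k ω)
      (fun _ => h1) (fun l => by rw [h2 l, latChar_add_intVec]; simp)]
    simp
  rw [← Lp.inner_fourier_eq, ← (integrable_inner_fiber _ _).2]
  refine integral_eq_zero_of_ae ?_
  filter_upwards [ae_all_iff.2 h0, ae_cube_of_ae hx,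
    ae_all_iff.2 fun j => ae_memℓp (Lp.memLp (𝓕 (w j) : L2 d))] with ω h1 h2 h3
  rw [fiber_eq_sum (f := (𝓕 x : L2 d)) (c := fun j => c j ω) h3 (fun l => by rw [h2 l]; simp only [hc])]
  simp [h1]

end Fibers

/-! ### Eckart–Young approximation with measurable coefficients -/

section EckartYoung

open scoped Matrix ComplexOrder

variable {ι : Type*} [Fintype ι]

/-- Power iteration: after division by the maximum `r`, only the entries equal to `r` survive, so
`t` is the uniform weight on them. -/
theorem tendsto_pow_div_sum_pow [Nonempty ι] {μ : ι → ℝ} (hμ : ∀ i, 0 ≤ μ i) (h0 : μ ≠ 0) :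
    ∃ r > 0, (∀ i, μ i ≤ r) ∧ ∃ t : ι → ℝ, t ≠ 0 ∧ (∀ i, μ i * t i = r * t i) ∧
      Tendsto (fun n : ℕ => fun i => μ i ^ n / ∑ j, μ j ^ n) atTop (𝓝 t) := by
  classical
  obtain ⟨m, hm⟩ := Finite.exists_max μ
  have hpos : 0 < μ m := by
    refine (hμ m).lt_of_ne' fun h => h0 (funext fun i => ?_)
    exact le_antisymm ((hm i).trans h.le) (hμ i)
  have hlim : ∀ i, Tendsto (fun n : ℕ => (μ i / μ m) ^ n) atTop
      (𝓝 (if μ i = μ m then 1 else 0)) := by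
    intro i
    split_ifs with h
    · simp [h, div_self hpos.ne']
    · exact tendsto_pow_atTop_nhds_zero_of_lt_one (div_nonneg (hμ i) hpos.le)
        ((div_lt_one hpos).2 (lt_of_le_of_ne (hm i) h))
  have hsum : (0 : ℝ) < ∑ j, if μ j = μ m then (1 : ℝ) else 0 :=
    Finset.sum_pos' (fun j _ => by positivity) ⟨m, Finset.mem_univ m, by simp⟩
  refine ⟨μ m, hpos, hm, fun i => (if μ i = μ m then 1 else 0) /
    ∑ j, if μ j = μ m then (1 : ℝ) else 0, fun h => ?_, fun i => ?_, ?_⟩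
  · have := congrFun h m
    simp only [if_true, Pi.zero_apply] at this
    exact (div_pos one_pos hsum).ne' this
  · dsimp only
    split_ifs with h
    · rw [h]
    · simp
  · rw [tendsto_pi_nhds]
    intro i
    have := (hlim i).div (tendsto_finsetSum Finset.univ fun j _ => hlim j) hsum.ne'
    refine this.congr fun n => ?_
    simp only [Pi.div_apply, div_pow, ← Finset.sum_div]
    rw [div_div_div_cancel_right₀ (pow_pos hpos n).ne']

/-- In an eigenbasis this is the scalar power iteration, and `P` is a multiple of the projection
onto the top eigenspace. As a limit of explicit functions of `A`, it is measurable in `A`, which a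
choice of eigenbasis need not be. -/
theorem tendsto_pow_div_trace [DecidableEq ι] {A : Matrix ι ι ℂ} (hA : A.PosSemidef)
    (h0 : A ≠ 0) :
    ∃ r : ℝ, 0 < r ∧ ∃ P : Matrix ι ι ℂ, P ≠ 0 ∧ A * P = (r : ℂ) • P ∧
      (∀ i j, Tendsto (fun n : ℕ => (A ^ n) i j / (A ^ n).trace) atTop (𝓝 (P i j))) ∧
      ((r : ℂ) • (1 : Matrix ι ι ℂ) - A).PosSemidef := by
  have hne : Nonempty ι := by
    by_contra h
    rw [not_nonempty_iff] at h
    exact h0 (Subsingleton.elim _ _)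
  set φ := Unitary.conjStarAlgAut ℂ (Matrix ι ι ℂ) hA.1.eigenvectorUnitary with hφ
  set μ := hA.1.eigenvalues with hμ
  have hAφ : A = φ (Matrix.diagonal fun i => (μ i : ℂ)) := hA.1.spectral_theorem
  have hμ0 : μ ≠ 0 := by
    intro h
    apply h0
    rw [hAφ, h]
    simp
  obtain ⟨r, hr, hle, t, ht0, ht, hlim⟩ := tendsto_pow_div_sum_pow hA.eigenvalues_nonneg hμ0
  have hpow : ∀ n : ℕ, A ^ n = φ (Matrix.diagonal fun i => (μ i : ℂ) ^ n) := by
    intro n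
    conv_lhs => rw [hAφ]
    rw [← map_pow, Matrix.diagonal_pow]
    rfl
  have htr : ∀ n : ℕ, (A ^ n).trace = ∑ i, (μ i : ℂ) ^ n := by
    intro n
    rw [hpow, hφ, Unitary.conjStarAlgAut_apply, Matrix.trace_mul_cycle]
    simp
  refine ⟨r, hr, φ (Matrix.diagonal fun i => (t i : ℂ)), ?_, ?_, ?_, ?_⟩
  · rw [Ne, EmbeddingLike.map_eq_zero_iff, Matrix.diagonal_eq_zero]
    intro h
    apply ht0
    funext i
    exact Complex.ofReal_eq_zero.1 (congrFun h i)
  · conv_lhs => rw [hAφ]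
    rw [← map_mul, Matrix.diagonal_mul_diagonal, ← map_smul, ← Matrix.diagonal_smul]
    congr 2
    funext i
    simp only [Pi.smul_apply, smul_eq_mul]
    exact_mod_cast ht i
  · intro i j
    have h1 : Tendsto (fun n : ℕ => fun i => ((μ i ^ n / ∑ j, μ j ^ n : ℝ) : ℂ)) atTop
        (𝓝 fun i => (t i : ℂ)) := by
      rw [tendsto_pi_nhds] at hlim ⊢
      exact fun i => (Complex.continuous_ofReal.tendsto _).comp (hlim i)
    have h2 : Continuous fun s : ι → ℂ => φ (Matrix.diagonal s) i j := by
      simp only [hφ, Unitary.conjStarAlgAut_apply]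
      fun_prop
    refine ((h2.tendsto _).comp h1).congr fun n => ?_
    rw [hpow n, ← hpow n, htr, hpow n, Function.comp_apply]
    have h3 : (Matrix.diagonal fun i => ((μ i ^ n / ∑ j, μ j ^ n : ℝ) : ℂ))
        = (∑ j, (μ j : ℂ) ^ n)⁻¹ • Matrix.diagonal fun i => (μ i : ℂ) ^ n := by
      rw [← Matrix.diagonal_smul]
      congr 1
      funext i
      simp [div_eq_inv_mul]
    rw [h3, map_smul, Matrix.smul_apply, smul_eq_mul, div_eq_inv_mul]
  · have h1 : (r : ℂ) • (1 : Matrix ι ι ℂ) - A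
        = φ (Matrix.diagonal fun i => ((r - μ i : ℝ) : ℂ)) := by
      conv_lhs => rw [hAφ, ← map_one φ, ← map_smul, ← map_sub, ← Matrix.diagonal_one,
        ← Matrix.diagonal_smul, Matrix.diagonal_sub]
      congr 2
      funext i
      simp
    rw [h1, hφ, Unitary.conjStarAlgAut_apply]
    refine Matrix.PosSemidef.mul_mul_conjTranspose_same (Matrix.PosSemidef.diagonal fun i => ?_) _
    simpa using hle i

theorem exists_measurable_nonzero {α κ : Type*} [MeasurableSpace α] [Finite κ]
    (f : κ → α → ι → ℂ) (hf : ∀ j, Measurable (f j)) :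
    ∃ g : α → ι → ℂ, Measurable g ∧ ∀ x, (∃ j, f j x ≠ 0) → g x ≠ 0 ∧ ∃ j, g x = f j x := by
  classical
  have := Fintype.ofFinite κ
  suffices h : ∀ s : Finset κ, ∃ g : α → ι → ℂ, Measurable g ∧
      ∀ x, (∃ j ∈ s, f j x ≠ 0) → g x ≠ 0 ∧ ∃ j, g x = f j x by
    simpa using h Finset.univ
  intro s
  induction s using Finset.induction_on with
  | empty => exact ⟨0, measurable_zero, by simp⟩
  | insert j s _ ih =>
    obtain ⟨g, hg, hgs⟩ := ih
    refine ⟨fun x => if f j x = 0 then g x else f j x,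
      Measurable.ite (hf j (measurableSet_singleton 0)) hg (hf j), fun x hx => ?_⟩
    by_cases h : f j x = 0
    · simp only [h, if_true]
      refine hgs x ?_
      obtain ⟨i, hi, hi'⟩ := hx
      exact ⟨i, (Finset.mem_insert.1 hi).resolve_left fun h' => hi' (h' ▸ h), hi'⟩
    · simp only [h, if_false]
      exact ⟨h, j, rfl⟩

/-- Since `A * P = r • P`, every nonzero column of the limit `P` is a top eigenvector;
`exists_measurable_nonzero` selects one, which is then normalized. -/
theorem exists_measurable_top_eigenvector :
    ∃ u : (ι → ι → ℂ) → ι → ℂ, Measurable u ∧ ∀ A : ι → ι → ℂ, (Matrix.of A).PosSemidef →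
      A ≠ 0 → ∃ r : ℝ, 0 < r ∧ Matrix.of A *ᵥ u A = (r : ℂ) • u A ∧ ∑ i, ‖u A i‖ ^ 2 = 1 ∧
        ∀ x : ι → ℂ, (star x ⬝ᵥ (Matrix.of A *ᵥ x)).re ≤ r * ∑ i, ‖x i‖ ^ 2 := by
  classical
  let f : ι → (ι → ι → ℂ) → ι → ℂ := fun j A i =>
    limUnder atTop fun n : ℕ => (Matrix.of A ^ n) i j / (Matrix.of A ^ n).trace
  have hf : ∀ j, Measurable (f j) := by
    intro j
    refine measurable_pi_lambda _ fun i => ?_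
    refine (StronglyMeasurable.limUnder fun n => ?_).measurable
    have hc : Continuous fun A : ι → ι → ℂ => Matrix.of A ^ n :=
      (show Continuous (Matrix.of : (ι → ι → ℂ) → Matrix ι ι ℂ) from continuous_id).pow n
    refine Measurable.stronglyMeasurable ?_
    exact (hc.matrix_elem i j).measurable.div hc.matrix_trace.measurable
  obtain ⟨g, hg, hgf⟩ := exists_measurable_nonzero f hf
  refine ⟨fun A i => ((√(∑ k, ‖g A k‖ ^ 2))⁻¹ : ℝ) * g A i, ?_, fun A hA hA0 => ?_⟩
  · fun_prop
  obtain ⟨r, hr, P, hP, hAP, hlim, hle⟩ := tendsto_pow_div_trace hA hA0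
  have hfP : ∀ i j, f j A i = P i j := fun i j => (hlim i j).limUnder_eq
  obtain ⟨hg0, j, hgj⟩ := hgf A (by
    by_contra! h
    exact hP (Matrix.ext fun i j => by rw [← hfP, h j]; rfl))
  have hpos : 0 < ∑ k, ‖g A k‖ ^ 2 := by
    obtain ⟨i, hi⟩ := Function.ne_iff.1 hg0
    exact Finset.sum_pos' (fun _ _ => by positivity)
      ⟨i, Finset.mem_univ i, by have := norm_pos_iff.2 hi; positivity⟩
  refine ⟨r, hr, ?_, ?_, fun x => ?_⟩
  · have h1 : Matrix.of A *ᵥ g A = (r : ℂ) • g A := by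
      have h2 : g A = P *ᵥ Pi.single j 1 := by
        rw [hgj, Matrix.mulVec_single_one]
        funext i
        exact hfP i j
      rw [h2, Matrix.mulVec_mulVec, hAP, Matrix.smul_mulVec]
    have h3 : (fun A i => (((√(∑ k, ‖g A k‖ ^ 2))⁻¹ : ℝ) : ℂ) * g A i) A
        = (((√(∑ k, ‖g A k‖ ^ 2))⁻¹ : ℝ) : ℂ) • g A := rfl
    rw [h3, Matrix.mulVec_smul, h1, smul_comm]
  · simp only [norm_mul, mul_pow, ← Finset.mul_sum, Complex.norm_real, norm_inv, inv_pow,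
      Real.norm_eq_abs, sq_abs, Real.sq_sqrt hpos.le]
    exact inv_mul_cancel₀ hpos.ne'
  · have h1 := hle.re_dotProduct_nonneg x
    rw [Matrix.sub_mulVec, dotProduct_sub, Matrix.smul_mulVec, Matrix.one_mulVec,
      dotProduct_smul] at h1
    have h2 : star x ⬝ᵥ x = ((∑ i, ‖x i‖ ^ 2 : ℝ) : ℂ) := by
      push_cast
      simp only [dotProduct, Pi.star_apply]
      exact Finset.sum_congr rfl fun i _ => Complex.conj_mul' (x i)
    rw [h2, smul_eq_mul, ← Complex.ofReal_mul, map_sub, RCLike.re_eq_complex_re,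
      Complex.ofReal_re] at h1
    linarith

variable {H : Type*} [NormedAddCommGroup H] [InnerProductSpace ℂ H]

/-- Pythagoras. Keeping `e` apart from `a` allows `e` to be `a` minus a vector orthogonal to `w`. -/
theorem norm_sub_inner_smul_sq {w a e : H} (hw : ‖w‖ = 1) (h : inner ℂ w e = inner ℂ w a) :
    ‖e - (inner ℂ w a : ℂ) • w‖ ^ 2 = ‖e‖ ^ 2 - ‖(inner ℂ w a : ℂ)‖ ^ 2 := by
  have h1 : inner ℂ (e - (inner ℂ w a : ℂ) • w) ((inner ℂ w a : ℂ) • w) = 0 := by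
    rw [inner_smul_right, inner_sub_left, inner_smul_left, inner_self_eq_norm_sq_to_K, hw,
      ← inner_conj_symm e w, h]
    simp
  have h2 := norm_add_sq_eq_norm_sq_add_norm_sq_of_inner_eq_zero _ _ h1
  rw [sub_add_cancel, norm_smul, hw, mul_one] at h2
  linarith

/-- Splitting off a maximizer of `w ↦ ∑ ‖⟨a j, w⟩‖ ^ 2` reduces the dimension of the subspaces
in the approximation of the vectors `a j` by one. -/
theorem exists_le_sum_norm_sub_sq {a : ι → H} {v : H} (hv : ‖v‖ = 1)
    (hmax : ∀ w : H, ‖w‖ = 1 →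
      ∑ j, ‖(inner ℂ w (a j) : ℂ)‖ ^ 2 ≤ ∑ j, ‖(inner ℂ v (a j) : ℂ)‖ ^ 2)
    {n : ℕ} (V : Submodule ℂ H) [FiniteDimensional ℂ V] (hV : Module.finrank ℂ V ≤ n + 1)
    {c : ι → H} (hc : ∀ j, c j ∈ V) :
    ∃ V' : Submodule ℂ H, FiniteDimensional ℂ V' ∧ Module.finrank ℂ V' ≤ n ∧
      ∃ c' : ι → H, (∀ j, c' j ∈ V') ∧
        ∑ j, ‖(a j - (inner ℂ v (a j) : ℂ) • v) - c' j‖ ^ 2 ≤ ∑ j, ‖a j - c j‖ ^ 2 := by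
  by_cases hbot : V = ⊥
  · refine ⟨⊥, inferInstance, by simp, 0, by simp, Finset.sum_le_sum fun j _ => ?_⟩
    have hcj : c j = 0 := by simpa [hbot] using hc j
    rw [hcj, Pi.zero_apply, sub_zero, sub_zero, norm_sub_inner_smul_sq hv rfl]
    linarith [sq_nonneg ‖(inner ℂ v (a j) : ℂ)‖]
  -- With `w` along the projection of `v`, the complement of `w` in `V` is orthogonal to `v` as well
  -- as to `w`. If the projection vanishes, any unit vector of `V` serves.
  obtain ⟨w, hwV, hw, t, ht⟩ : ∃ w ∈ V, ‖w‖ = 1 ∧ ∃ t : ℂ, V.starProjection v = t • w := by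
    by_cases hp : V.starProjection v = 0
    · obtain ⟨x, hx, hx0⟩ := Submodule.exists_mem_ne_zero_of_ne_bot hbot
      exact ⟨(‖x‖⁻¹ : ℂ) • x, V.smul_mem _ hx, norm_smul_inv_norm hx0, 0, by rw [hp, zero_smul]⟩
    · refine ⟨(‖V.starProjection v‖⁻¹ : ℂ) • V.starProjection v,
        V.smul_mem _ (V.starProjection_apply_mem v), norm_smul_inv_norm hp,
        (‖V.starProjection v‖ : ℂ), ?_⟩
      rw [smul_smul, mul_inv_cancel₀, one_smul]
      exact_mod_cast (norm_ne_zero_iff.2 hp)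
  have hww : inner ℂ w w = (1 : ℂ) := by rw [inner_self_eq_norm_sq_to_K, hw]; simp
  set V' : Submodule ℂ H := V ⊓ (ℂ ∙ w)ᗮ with hV'
  have hlt : V' < V := by
    refine lt_of_le_of_ne inf_le_left fun h => ?_
    have : w ∈ V' := h ▸ hwV
    have := Submodule.mem_orthogonal_singleton_iff_inner_right.1 this.2
    rw [hww] at this
    exact one_ne_zero this
  have hfd : FiniteDimensional ℂ V' := Submodule.finiteDimensional_of_le hlt.le
  have hvV' : ∀ x ∈ V', inner ℂ v x = (0 : ℂ) := by
    intro x hx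
    have h1 : inner ℂ (v - V.starProjection v) x = (0 : ℂ) :=
      V.starProjection_inner_eq_zero v x hx.1
    rw [inner_sub_left, ht, inner_smul_left,
      Submodule.mem_orthogonal_singleton_iff_inner_right.1 hx.2, mul_zero, sub_zero] at h1
    exact h1
  have hwV' : ∀ x ∈ V', inner ℂ w x = (0 : ℂ) := fun x hx =>
    Submodule.mem_orthogonal_singleton_iff_inner_right.1 hx.2
  -- `V` is the orthogonal sum of `V'` and the line of `w`, so the left side is the squared distance
  -- from `a j` to `V`. Maximality of `v` then permits replacing `w` by `v`.
  have hle : ∀ j, ‖a j - V'.starProjection (a j)‖ ^ 2 - ‖(inner ℂ w (a j) : ℂ)‖ ^ 2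
      ≤ ‖a j - c j‖ ^ 2 := by
    intro j
    have hmem := V'.starProjection_apply_mem (a j)
    have hin : inner ℂ w (a j - V'.starProjection (a j)) = (inner ℂ w (a j) : ℂ) := by
      rw [inner_sub_right, hwV' _ hmem, sub_zero]
    rw [← norm_sub_inner_smul_sq hw hin]
    set q := a j - V'.starProjection (a j) - (inner ℂ w (a j) : ℂ) • w with hq
    have hqw : inner ℂ w q = (0 : ℂ) := by
      rw [hq, inner_sub_right, hin, inner_smul_right, hww, mul_one, sub_self]
    have hqV : ∀ x ∈ V, inner ℂ q x = (0 : ℂ) := by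
      intro x hx
      have hx' : x - (inner ℂ w x : ℂ) • w ∈ V' := by
        refine ⟨V.sub_mem hx (V.smul_mem _ hwV),
          Submodule.mem_orthogonal_singleton_iff_inner_right.2 ?_⟩
        rw [inner_sub_right,
          inner_smul_right, hww, mul_one, sub_self]
      have h1 : inner ℂ q (x - (inner ℂ w x : ℂ) • w) = (0 : ℂ) := by
        rw [hq, inner_sub_left, V'.starProjection_inner_eq_zero _ _ hx', inner_smul_left,
          hwV' _ hx', mul_zero, sub_zero]
      rw [inner_sub_right, inner_smul_right, ← inner_conj_symm q w, hqw, map_zero, mul_zero,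
        sub_zero] at h1
      exact h1
    have h2 : a j - c j = q + (V'.starProjection (a j) + (inner ℂ w (a j) : ℂ) • w - c j) := by
      rw [hq]; abel
    have h3 := norm_add_sq_eq_norm_sq_add_norm_sq_of_inner_eq_zero _ _ (hqV _
      (V.sub_mem (V.add_mem hmem.1 (V.smul_mem (inner ℂ w (a j) : ℂ) hwV)) (hc j)))
    rw [h2]
    nlinarith [h3, norm_nonneg (V'.starProjection (a j) + (inner ℂ w (a j) : ℂ) • w - c j)]
  refine ⟨V', hfd, by have := Submodule.finrank_lt_finrank_of_lt hlt; omega,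
    fun j => V'.starProjection (a j), fun j => V'.starProjection_apply_mem (a j), ?_⟩
  have heq : ∀ j, ‖(a j - (inner ℂ v (a j) : ℂ) • v) - V'.starProjection (a j)‖ ^ 2
      = ‖a j - V'.starProjection (a j)‖ ^ 2 - ‖(inner ℂ v (a j) : ℂ)‖ ^ 2 := by
    intro j
    rw [sub_right_comm]
    refine norm_sub_inner_smul_sq hv ?_
    rw [inner_sub_right, hvV' _ (V'.starProjection_apply_mem (a j)), sub_zero]
  simp only [heq, Finset.sum_sub_distrib]
  have h1 := Finset.sum_le_sum fun j (_ : j ∈ Finset.univ) => hle j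
  rw [Finset.sum_sub_distrib] at h1
  linarith [hmax w hw]

/-- An operator and its adjoint have the same norm: the bound on `x ↦ ∑ x j • a j` is tested at the
coefficients `⟨a j, w⟩`. -/
theorem sum_norm_inner_sq_le {a : ι → H} {r : ℝ} (hr : 0 ≤ r)
    (h : ∀ x : ι → ℂ, ‖∑ j, x j • a j‖ ^ 2 ≤ r * ∑ j, ‖x j‖ ^ 2) (w : H) :
    ∑ j, ‖(inner ℂ w (a j) : ℂ)‖ ^ 2 ≤ r * ‖w‖ ^ 2 := by
  set s := ∑ j, ‖(inner ℂ w (a j) : ℂ)‖ ^ 2 with hs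
  have hs0 : 0 ≤ s := Finset.sum_nonneg fun _ _ => by positivity
  set y := ∑ j, (inner ℂ (a j) w : ℂ) • a j with hy
  have h1 : ‖y‖ ^ 2 ≤ r * s := by
    convert h (fun j => inner ℂ (a j) w) using 4
    exact norm_inner_symm _ _
  have h2 : inner ℂ w y = (s : ℂ) := by
    rw [hy, inner_sum, hs]
    push_cast
    refine Finset.sum_congr rfl fun j _ => ?_
    rw [inner_smul_right, ← inner_conj_symm (a j) w, Complex.conj_mul']
  have h3 : s ≤ ‖w‖ * ‖y‖ := by
    have := norm_inner_le_norm (𝕜 := ℂ) w y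
    rwa [h2, Complex.norm_real, Real.norm_of_nonneg hs0] at this
  have h4 : s * s ≤ (r * ‖w‖ ^ 2) * s := by
    calc s * s ≤ (‖w‖ * ‖y‖) * (‖w‖ * ‖y‖) := mul_self_le_mul_self hs0 h3
      _ = ‖w‖ ^ 2 * ‖y‖ ^ 2 := by ring
      _ ≤ ‖w‖ ^ 2 * (r * s) := by gcongr
      _ = _ := by ring
  rcases hs0.eq_or_lt with h5 | h5
  · rw [← h5]; positivity
  · exact le_of_mul_le_mul_right h4 h5

/-- The Gram matrix of a family. -/
def gramFun (a : ι → H) : ι → ι → ℂ := fun i j => inner ℂ (a i) (a j)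

theorem of_gramFun {κ : Type*} (a : κ → H) : Matrix.of (gramFun a) = Matrix.gram ℂ a := rfl

theorem re_dotProduct_gramFun (a : ι → H) (x : ι → ℂ) :
    (star x ⬝ᵥ (Matrix.of (gramFun a) *ᵥ x)).re = ‖∑ j, x j • a j‖ ^ 2 := by
  rw [of_gramFun, Matrix.star_dotProduct_gram_mulVec, inner_self_eq_norm_sq_to_K]
  norm_cast

/-- The new Gram matrix is polynomial in the old one and `T`, so deflation preserves measurable
dependence. -/
theorem gramFun_sum {κ : Type*} (T : κ → ι → ℂ) (a : ι → H) (i j : κ) :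
    gramFun (fun k => ∑ l, T k l • a l) i j
      = ∑ l, ∑ m, star (T i l) * T j m * gramFun a l m := by
  simp only [gramFun]
  rw [sum_inner]
  refine Finset.sum_congr rfl fun l _ => ?_
  rw [inner_smul_left, inner_sum, Finset.mul_sum]
  refine Finset.sum_congr rfl fun m _ => ?_
  rw [inner_smul_right, RCLike.star_def]
  ring

/-- For a top eigenvector `x` of the Gram matrix, with eigenvalue `r`, the vector `∑ x j • a j` has
norm `√r`; divided by `√r` it is a top singular vector of the family. -/
theorem exists_measurable_maximizer (ι : Type*) [Fintype ι] :
    ∃ u : (ι → ι → ℂ) → ι → ℂ, Measurable u ∧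
      ∀ {H : Type} [NormedAddCommGroup H] [InnerProductSpace ℂ H] (a : ι → H), a ≠ 0 →
        ‖∑ j, u (gramFun a) j • a j‖ = 1 ∧ ∀ w : H, ‖w‖ = 1 →
          ∑ j, ‖(inner ℂ w (a j) : ℂ)‖ ^ 2
            ≤ ∑ j, ‖(inner ℂ (∑ j, u (gramFun a) j • a j) (a j) : ℂ)‖ ^ 2 := by
  obtain ⟨u, hu, hu'⟩ := exists_measurable_top_eigenvector (ι := ι)
  refine ⟨fun A j => (((√(star (u A) ⬝ᵥ (Matrix.of A *ᵥ u A)).re)⁻¹ : ℝ) : ℂ) * u A j,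
    ?_, fun {H} _ _ a ha => ?_⟩
  · simp only [dotProduct, Matrix.mulVec, Matrix.of_apply, Pi.star_apply]
    fun_prop
  have hA0 : gramFun a ≠ 0 := by
    intro h
    apply ha
    funext j
    exact inner_self_eq_zero.1 (congrFun (congrFun h j) j)
  obtain ⟨r, hr, h1, h2, h3⟩ := hu' (gramFun a) (Matrix.posSemidef_gram ℂ a) hA0
  set x := u (gramFun a) with hx
  simp only [re_dotProduct_gramFun] at h3
  have hnorm : ‖∑ j, x j • a j‖ ^ 2 = r := by
    rw [← re_dotProduct_gramFun, h1, dotProduct_smul]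
    have : star x ⬝ᵥ x = ((∑ i, ‖x i‖ ^ 2 : ℝ) : ℂ) := by
      push_cast
      simp only [dotProduct, Pi.star_apply]
      exact Finset.sum_congr rfl fun i _ => Complex.conj_mul' (x i)
    rw [this, h2]
    simp
  have hnorm' : ‖∑ j, x j • a j‖ = √r := by rw [← hnorm, Real.sqrt_sq (norm_nonneg _)]
  have hv : ∑ j, ((((√(star x ⬝ᵥ (Matrix.of (gramFun a) *ᵥ x)).re)⁻¹ : ℝ) : ℂ) * x j) • a j
      = (((√r)⁻¹ : ℝ) : ℂ) • ∑ j, x j • a j := by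
    rw [re_dotProduct_gramFun, hnorm, Finset.smul_sum]
    simp only [mul_smul]
  have hinner : ∀ j, ‖(inner ℂ (∑ l, x l • a l) (a j) : ℂ)‖ = r * ‖x j‖ := by
    intro j
    have : inner ℂ (a j) (∑ l, x l • a l) = (r : ℂ) * x j := by
      have := congrFun h1 j
      rw [Pi.smul_apply, smul_eq_mul] at this
      rw [← this, inner_sum]
      simp only [inner_smul_right, Matrix.mulVec, dotProduct, Matrix.of_apply, gramFun, mul_comm]
    rw [norm_inner_symm, this, norm_mul, Complex.norm_real, Real.norm_of_nonneg hr.le]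
  rw [hv]
  refine ⟨?_, fun w hw => ?_⟩
  · rw [norm_smul, hnorm', Complex.norm_real, Real.norm_of_nonneg (by positivity)]
    exact inv_mul_cancel₀ (Real.sqrt_pos.2 hr).ne'
  · refine (sum_norm_inner_sq_le hr.le h3 w).trans (le_of_eq ?_)
    simp only [inner_smul_left, norm_mul, hinner, RCLike.norm_conj, Complex.norm_real, mul_pow,
      ← Finset.mul_sum, h2, hw]
    rw [norm_inv, inv_pow, Real.norm_eq_abs, sq_abs, Real.sq_sqrt hr.le]
    field_simp

/-- Optimal approximation of a finite family by subspaces of dimension at most `n`, with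
coefficients that depend measurably on the Gram matrix. -/
theorem exists_measurable_optimal_approximation (ι : Type*) [Fintype ι] (n : ℕ) :
    ∃ (U : (ι → ι → ℂ) → Fin n → ι → ℂ) (C : (ι → ι → ℂ) → ι → Fin n → ℂ),
      Measurable U ∧ Measurable C ∧
      ∀ {H : Type} [NormedAddCommGroup H] [InnerProductSpace ℂ H] (a : ι → H),
        (∀ s, ‖∑ j, U (gramFun a) s j • a j‖ ≤ 1) ∧
        ∀ (V : Submodule ℂ H) [FiniteDimensional ℂ V], Module.finrank ℂ V ≤ n →
          ∀ c : ι → H, (∀ j, c j ∈ V) →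
            ∑ j, ‖a j - ∑ s, C (gramFun a) j s • ∑ l, U (gramFun a) s l • a l‖ ^ 2
              ≤ ∑ j, ‖a j - c j‖ ^ 2 := by
  classical
  induction n with
  | zero =>
    refine ⟨0, 0, measurable_zero, measurable_zero, fun a => ⟨by simp, fun V _ hV c hc => ?_⟩⟩
    have hV0 : V = ⊥ := Submodule.finrank_eq_zero.1 (Nat.le_zero.1 hV)
    have hc0 : ∀ j, c j = 0 := fun j => by simpa [hV0] using hc j
    simp [hc0]
  | succ n ih =>
    obtain ⟨U, C, hU, hC, h⟩ := ih
    obtain ⟨u, hu, hmax⟩ := exists_measurable_maximizer ι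
    -- For `v = ∑ u A l • a l`, `q` gives `⟨v, a j⟩`, `T` the matrix of the deflation `a j - ⟨v, a
    -- j⟩ v`, and `A'` the Gram matrix of the deflated family, to which the induction hypothesis
    -- applies.
    let q : (ι → ι → ℂ) → ι → ℂ := fun A j => ∑ l, star (u A l) * A l j
    let T : (ι → ι → ℂ) → ι → ι → ℂ := fun A j l => (if j = l then 1 else 0) - q A j * u A l
    let A' : (ι → ι → ℂ) → ι → ι → ℂ := fun A i j =>
      ∑ l, ∑ m, star (T A i l) * T A j m * A l m
    have hq : Measurable q := by fun_prop
    have hT : Measurable T := by fun_prop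
    have hA' : Measurable A' := by fun_prop
    refine ⟨fun A => Fin.cons (u A) fun s l => ∑ j, U (A' A) s j * T A j l,
      fun A j => Fin.cons (q A j) (C (A' A) j), ?_, ?_, fun {H} _ _ a => ?_⟩
    · refine measurable_pi_lambda _ fun s => ?_
      refine Fin.cases ?_ (fun s => ?_) s
      · simpa using hu
      · simp only [Fin.cons_succ]
        have := hU.comp hA'
        fun_prop
    · refine measurable_pi_lambda _ fun j => measurable_pi_lambda _ fun s => ?_
      refine Fin.cases ?_ (fun s => ?_) s
      · simp only [Fin.cons_zero]
        fun_prop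
      · simp only [Fin.cons_succ]
        have := hC.comp hA'
        fun_prop
    set A := gramFun a with hA
    set v := ∑ j, u A j • a j with hv
    have hqv : ∀ j, q A j = inner ℂ v (a j) := by
      intro j
      simp only [q, hv, sum_inner, inner_smul_left, RCLike.star_def]
      rfl
    have ha' : (fun j => ∑ l, T A j l • a l) = fun j => a j - (inner ℂ v (a j) : ℂ) • v := by
      funext j
      simp only [T, sub_smul, Finset.sum_sub_distrib, ite_smul, one_smul, zero_smul,
        Finset.sum_ite_eq, Finset.mem_univ, if_true, mul_smul, ← Finset.smul_sum, hqv, ← hv]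
    have hgram : A' A = gramFun fun j => a j - (inner ℂ v (a j) : ℂ) • v := by
      funext i j
      rw [← ha', gramFun_sum]
    have hsucc : ∀ s, ∑ l, (∑ j, U (A' A) s j * T A j l) • a l
        = ∑ j, U (A' A) s j • (a j - (inner ℂ v (a j) : ℂ) • v) := by
      intro s
      simp only [← congrFun ha', Finset.sum_smul, Finset.smul_sum, smul_smul]
      exact Finset.sum_comm
    obtain ⟨h1, h2⟩ := h fun j => a j - (inner ℂ v (a j) : ℂ) • v
    rw [← hgram] at h1 h2
    refine ⟨fun s => ?_, fun V _ hV c hc => ?_⟩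
    · refine Fin.cases ?_ (fun s => ?_) s
      · simp only [Fin.cons_zero]
        by_cases ha : a = 0
        · simp [ha]
        · exact (hmax a ha).1.le
      · simp only [Fin.cons_succ, hsucc]
        exact h1 s
    · simp only [Fin.sum_univ_succ, Fin.cons_zero, Fin.cons_succ, hsucc, ← hv, hqv, ← sub_sub]
      -- For `a = 0` no unit maximizer is available; comparison with the zero subspace shows that
      -- the error is zero.
      by_cases ha : a = 0
      · refine (h2 ⊥ (by simp) 0 (by simp)).trans ?_
        simp only [ha, Pi.zero_apply, inner_zero_right, zero_smul, sub_zero, norm_zero]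
        simp only [ne_eq, OfNat.ofNat_ne_zero, not_false_eq_true, zero_pow, Finset.sum_const_zero]
        positivity
      · obtain ⟨V', hfd, hV', c', hc', hle⟩ :=
          exists_le_sum_norm_sub_sq (hmax a ha).1 (hmax a ha).2 V hV hc
        exact (h2 V' hV' c' hc').trans hle

end EckartYoung

/-! ### A fundamental domain for `G` on frequencies modulo the lattice -/

section Tiling

variable {d : ℕ}

/-- A measurable injection of the fractional parts into `ℝ` orders the cosets of `ℤ^d`, so that a
finite orbit has a least coset. -/
theorem exists_measurable_latticeInvariant (d : ℕ) : ∃ κ : Eucl d → ℝ, Measurable κ ∧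
    ∀ ω ω', κ ω = κ ω' ↔ ∃ k, ω' = ω + intVec k := by
  obtain ⟨e, he⟩ := exists_measurableEmbedding_real (Fin d → ℝ)
  refine ⟨fun ω => e fun i => Int.fract (ω i), he.measurable.comp ?_, fun ω ω' => ?_⟩
  · exact measurable_pi_lambda _ fun i => measurable_fract.comp (by fun_prop)
  · rw [he.injective.eq_iff, funext_iff]
    constructor
    · intro h
      choose z hz using fun i => Int.fract_eq_fract.1 (h i)
      refine ⟨fun i => -z i, ?_⟩
      ext i
      simp only [PiLp.add_apply, intVec_apply, Int.cast_neg]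
      linarith [hz i]
    · rintro ⟨k, rfl⟩ i
      simp [intVec_apply]

variable {G : Type*} [Group G] (ρ : G →* (Eucl d ≃L[ℝ] Eucl d))

/-- `ℤ^d` is its own dual lattice: each coordinate is the inner product of `k` with `ρ g⁻¹` of a
basis vector, which is integral. -/
theorem freqAct_intVec (hlattice : ∀ g : G, ρ g '' intLattice d = intLattice d) (g : G)
    (k : Fin d → ℤ) : ∃ l, freqAct ρ g (intVec k) = intVec l := by
  have h : ∀ i : Fin d, ∃ n : ℤ, freqAct ρ g (intVec k) i = n := by
    intro i
    obtain ⟨l, hl⟩ : ρ g⁻¹ (intVec (Pi.single i 1)) ∈ intLattice d :=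
      (hlattice g⁻¹).subset (Set.mem_image_of_mem _ ⟨_, rfl⟩)
    refine ⟨∑ j, k j * l j, ?_⟩
    rw [← inner_intVec_intVec, hl, ← ContinuousLinearEquiv.coe_coe,
      ← ContinuousLinearMap.adjoint_inner_right]
    simp [PiLp.inner_apply, intVec_apply, Pi.single_apply, freqAct]
  choose l hl using h
  exact ⟨l, by ext i; exact hl i⟩

theorem freqAct_injective (hρ : Function.Injective ρ) {g : G}
    (h : ∀ ω, freqAct ρ g ω = ω) : g = 1 := by
  apply hρ
  rw [map_one]
  refine ContinuousLinearEquiv.ext (funext fun x => ?_)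
  refine ext_inner_right ℝ fun ω => ?_
  rw [← h ω, inner_freqAct, h]
  rfl

/-- The solutions of `gω = ω + v` are empty or a coset of the kernel of `g - 1`, a proper subspace
by faithfulness, hence a null set. -/
theorem ae_freqAct_ne_add (hρ : Function.Injective ρ) {g : G} (hg : g ≠ 1) (v : Eucl d) :
    ∀ᵐ ω, freqAct ρ g ω ≠ ω + v := by
  set K : Submodule ℝ (Eucl d) :=
    LinearMap.ker ((freqAct ρ g : Eucl d →ₗ[ℝ] Eucl d) - LinearMap.id) with hK
  have hKtop : K ≠ ⊤ := by
    intro h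
    refine hg (freqAct_injective ρ hρ fun ω => ?_)
    have : ω ∈ K := h ▸ Submodule.mem_top
    simpa [hK, sub_eq_zero] using this
  by_cases hne : ∃ ω₀, freqAct ρ g ω₀ = ω₀ + v
  · obtain ⟨ω₀, h₀⟩ := hne
    have h1 := Measure.addHaar_submodule (volume : Measure (Eucl d)) K hKtop
    have h2 : ∀ᵐ ω : Eucl d, ω ∉ K := measure_eq_zero_iff_ae_notMem.1 h1
    filter_upwards [(measurePreserving_sub_right volume ω₀).quasiMeasurePreserving.ae h2]
      with ω hω h
    apply hω
    simp only [hK, LinearMap.mem_ker, LinearMap.sub_apply, ContinuousLinearMap.coe_coe, map_sub,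
      LinearMap.id_apply, h, h₀]
    abel
  · exact Eventually.of_forall fun ω h => hne ⟨ω, h⟩

/-- A fundamental domain for the action of `Γ` on the frequencies, modulo the lattice. -/
theorem exists_frequencyDomain [Finite G] (hρ : Function.Injective ρ)
    (hlattice : ∀ g : G, ρ g '' intLattice d = intLattice d) :
    ∃ D : Set (Eucl d), MeasurableSet D ∧ (∀ ω k, ω + intVec k ∈ D ↔ ω ∈ D) ∧
      (∀ ω g h, freqAct ρ g ω ∈ D → freqAct ρ h ω ∈ D → g = h) ∧
      ∀ᵐ ω, ∃ g, freqAct ρ g ω ∈ D := by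
  obtain ⟨κ, hκ, hκ'⟩ := exists_measurable_latticeInvariant d
  -- `D` consists of the strict minimizers of `κ` in their orbits. Strictness gives uniqueness;
  -- almost every orbit is free modulo the lattice, so its minimum is strict.
  refine ⟨{ω | ∀ g : G, g ≠ 1 → κ ω < κ (freqAct ρ g ω)}, ?_, fun ω k => ?_,
    fun ω g h hg hh => ?_, ?_⟩
  · simp only [Set.ofPred_forall]
    exact MeasurableSet.iInter fun g => MeasurableSet.iInter fun _ =>
      measurableSet_lt hκ (hκ.comp (freqAct ρ g).continuous.measurable)
  · have h1 : κ (ω + intVec k) = κ ω := ((hκ' _ _).2 ⟨k, rfl⟩).symm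
    have h2 : ∀ g, κ (freqAct ρ g (ω + intVec k)) = κ (freqAct ρ g ω) := by
      intro g
      obtain ⟨l, hl⟩ := freqAct_intVec ρ hlattice g k
      exact ((hκ' _ _).2 ⟨l, by rw [map_add, hl]⟩).symm
    simp only [Set.mem_ofPred_eq, h1, h2]
  · by_contra hne
    have h1 := hg (h * g⁻¹) fun h' => hne (mul_inv_eq_one.1 h').symm
    have h2 := hh (g * h⁻¹) fun h' => hne (mul_inv_eq_one.1 h')
    rw [← freqAct_mul, inv_mul_cancel_right] at h1 h2
    exact lt_asymm h1 h2
  · have h1 : ∀ᵐ ω, ∀ (g : G) (h : G), h ≠ 1 → ∀ k,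
        freqAct ρ h (freqAct ρ g ω) ≠ freqAct ρ g ω + intVec k := by
      refine ae_all_iff.2 fun g => ?_
      refine (measurePreserving_freqAct ρ g).quasiMeasurePreserving.ae
        (p := fun ω => ∀ h : G, h ≠ 1 → ∀ k, freqAct ρ h ω ≠ ω + intVec k) ?_
      refine ae_all_iff.2 fun h => ?_
      by_cases hh : h = 1
      · exact Eventually.of_forall fun ω h' => absurd hh h'
      · filter_upwards [ae_all_iff.2 fun k => ae_freqAct_ne_add ρ hρ hh (intVec k)]
          with ω hω _ using hω
    filter_upwards [h1] with ω hω
    obtain ⟨g, hg⟩ := Finite.exists_min fun g : G => κ (freqAct ρ g ω)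
    refine ⟨g, fun h hh => lt_of_le_of_ne ?_ fun heq => ?_⟩
    · rw [← freqAct_mul]
      exact hg _
    · obtain ⟨k, hk⟩ := (hκ' _ _).1 heq
      exact hω g h hh k hk

theorem lintegral_eq_sum_domain [Fintype G] {D : Set (Eucl d)} (hD : MeasurableSet D)
    (hdisj : ∀ ω g h, freqAct ρ g ω ∈ D → freqAct ρ h ω ∈ D → g = h)
    (hcov : ∀ᵐ ω, ∃ g, freqAct ρ g ω ∈ D) {f : Eucl d → ENNReal} (hf : AEMeasurable f) :
    ∫⁻ ω, f ω = ∑ g : G, ∫⁻ ω, D.indicator (fun ω => f (freqAct ρ g⁻¹ ω)) ω := by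
  classical
  have h1 : ∀ᵐ ω, f ω = ∑ g : G, (freqAct ρ g ⁻¹' D).indicator f ω := by
    filter_upwards [hcov] with ω ⟨g, hg⟩
    rw [Finset.sum_eq_single g, Set.indicator_of_mem (s := freqAct ρ g ⁻¹' D) hg]
    · exact fun h _ hh => Set.indicator_of_notMem (s := freqAct ρ h ⁻¹' D) (fun h' => hh (hdisj ω h g h' hg)) _
    · simp
  have hmeas : ∀ g, MeasurableSet (freqAct ρ g ⁻¹' D) := fun g =>
    hD.preimage (freqAct ρ g).continuous.measurable
  rw [lintegral_congr_ae h1, lintegral_finsetSum' _ fun g _ => hf.indicator (hmeas g)]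
  refine Finset.sum_congr rfl fun g _ => ?_
  rw [← (measurePreserving_freqAct ρ g⁻¹).lintegral_comp_emb
    (freqHom ρ g⁻¹).toHomeomorph.measurableEmbedding]
  congr 1 with ω
  simp only [Set.indicator, Set.mem_preimage, ← freqAct_mul, mul_inv_cancel, freqAct_one]

theorem aemeasurable_enorm_fiber_sq {f : Eucl d → ℂ} (hf : MemLp f 2) :
    AEMeasurable (fun ω => ‖fiber f ω‖ₑ ^ 2) (cubeMeasure d) := by
  have h1 : AEMeasurable fun ω => ‖f ω‖ₑ ^ 2 := hf.1.enorm.pow_const 2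
  have h3 : AEMeasurable (fun ω => ∑' k, ‖f (ω + intVec k)‖ₑ ^ 2) (cubeMeasure d) :=
    AEMeasurable.tsum fun k => (h1.comp_quasiMeasurePreserving
      (measurePreserving_add_right volume (intVec k)).quasiMeasurePreserving).restrict
  refine h3.congr ?_
  filter_upwards [ae_memℓp hf] with ω hω
  rw [enorm_fiber_sq hω]

theorem enorm_sq_eq_lintegral (x : L2 d) : ‖x‖ₑ ^ 2 = ∫⁻ ω, ‖x ω‖ₑ ^ 2 := by
  rw [Lp.enorm_def, eLpNorm_eq_lintegral_rpow_enorm_toReal (by norm_num) (by norm_num),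
    ← ENNReal.rpow_natCast, ← ENNReal.rpow_mul]
  simp

/-- The norm of a family in terms of the fibers over a fundamental domain for `Γ`. -/
theorem sum_enorm_sq_eq_lintegral_fiber [Fintype G] {D : Set (Eucl d)} (hD : MeasurableSet D)
    (hper : ∀ ω k, ω + intVec k ∈ D ↔ ω ∈ D)
    (hdisj : ∀ ω g h, freqAct ρ g ω ∈ D → freqAct ρ h ω ∈ D → g = h)
    (hcov : ∀ᵐ ω, ∃ g, freqAct ρ g ω ∈ D) {ι : Type*} [Fintype ι] (x : ι → L2 d) :
    ∑ i, ‖x i‖ₑ ^ 2 = ∫⁻ ω, D.indicator (fun ω => ∑ p : ι × G,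
      ‖fiber (𝓕 (rotOp ρ p.2 (x p.1)) : L2 d) ω‖ₑ ^ 2) ω ∂cubeMeasure d := by
  rw [lintegral_indicator hD, lintegral_finsetSum' _ fun p _ =>
    (aemeasurable_enorm_fiber_sq (Lp.memLp _)).restrict, Fintype.sum_prod_type]
  refine Finset.sum_congr rfl fun i _ => ?_
  have h1 : ‖x i‖ₑ ^ 2 = ‖(𝓕 (x i) : L2 d)‖ₑ ^ 2 := by
    rw [← ofReal_norm, ← ofReal_norm, Lp.norm_fourier_eq]
  rw [h1, enorm_sq_eq_lintegral, lintegral_eq_sum_domain ρ hD hdisj hcov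
    ((Lp.memLp _).1.enorm.pow_const 2)]
  refine Finset.sum_congr rfl fun g _ => ?_
  have h2 : ∀ᵐ ω, D.indicator (fun ω => ‖(𝓕 (x i) : L2 d) (freqAct ρ g⁻¹ ω)‖ₑ ^ 2) ω
      = D.indicator (fun ω => ‖(𝓕 (rotOp ρ g (x i)) : L2 d) ω‖ₑ ^ 2) ω := by
    filter_upwards [fourier_rotOp ρ g (x i)] with ω hω
    simp only [Set.indicator, hω]
  rw [lintegral_congr_ae h2, lintegral_eq_lintegral_cube _
    (((Lp.memLp _).1.enorm.pow_const 2).indicator hD), ← lintegral_indicator hD]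
  refine lintegral_congr_ae ?_
  filter_upwards [ae_memℓp (Lp.memLp (𝓕 (rotOp ρ g (x i)) : L2 d))] with ω hω
  by_cases hωD : ω ∈ D
  · simp [Set.indicator, hper, hωD, enorm_fiber_sq hω]
  · simp [Set.indicator, hper, hωD]

end Tiling

/-! ### `Γ`-invariant subspaces and their fibers -/

section GammaInvariance

variable {d : ℕ} {G : Type*} [Group G] [Finite G] (ρ : G →* (Eucl d ≃L[ℝ] Eucl d))

theorem shiftOp_shiftOp (k l : Fin d → ℤ) (f : L2 d) :
    shiftOp k (shiftOp l f) = shiftOp (k + l) f := by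
  apply Lp.ext
  filter_upwards [coeFn_shiftOp k (shiftOp l f), coeFn_shiftOp (k + l) f,
    (measurePreserving_sub_right volume (intVec k)).quasiMeasurePreserving.ae
      (coeFn_shiftOp l f)] with x h1 h2 h3
  rw [h1, h2, h3, intVec_add, sub_sub]

theorem shiftOp_zero (f : L2 d) : shiftOp 0 f = f := by
  apply Lp.ext
  filter_upwards [coeFn_shiftOp 0 f] with x h1
  have : intVec (0 : Fin d → ℤ) = 0 := by ext i; simp [intVec_apply]
  rw [h1, this, sub_zero]

theorem rotOp_one (f : L2 d) : rotOp ρ 1 f = f := by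
  apply Lp.ext
  filter_upwards [coeFn_rotOp ρ 1 f] with x h1
  rw [h1, inv_one, map_one]
  rfl

theorem rotOp_rotOp (g h : G) (f : L2 d) : rotOp ρ g (rotOp ρ h f) = rotOp ρ (g * h) f := by
  apply Lp.ext
  filter_upwards [coeFn_rotOp ρ g (rotOp ρ h f), coeFn_rotOp ρ (g * h) f,
    (measurePreserving_of_finite ρ g⁻¹).quasiMeasurePreserving.ae
      (coeFn_rotOp ρ h f)] with x h1 h2 h3
  rw [h1, h2, h3, mul_inv_rev, map_mul]
  rfl

theorem rotOp_shiftOp {g : G} {k l : Fin d → ℤ} (h : ρ g (intVec k) = intVec l) (f : L2 d) :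
    rotOp ρ g (shiftOp k f) = shiftOp l (rotOp ρ g f) := by
  apply Lp.ext
  filter_upwards [coeFn_rotOp ρ g (shiftOp k f), coeFn_shiftOp l (rotOp ρ g f),
    (measurePreserving_of_finite ρ g⁻¹).quasiMeasurePreserving.ae
      (coeFn_shiftOp k f),
    (measurePreserving_sub_right volume (intVec l)).quasiMeasurePreserving.ae
      (coeFn_rotOp ρ g f)] with x h1 h2 h3 h4
  have h5 : ρ g⁻¹ (intVec l) = intVec k := by
    rw [← h, map_inv]
    exact (ρ g).symm_apply_apply _
  rw [h1, h2, h3, h4, map_sub, h5]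

/-- The algebraic span of the orbits of a finite family under `Γ`. -/
def gammaOrbitSpan {n : ℕ} (Φ : Fin n → L2 d) : Submodule ℂ (L2 d) :=
  Submodule.span ℂ {h : L2 d | ∃ (k : Fin d → ℤ) (g : G) (i : Fin n),
    h = shiftOp k (rotOp ρ g (Φ i))}

variable {ρ}

theorem isGammaInvariant_gammaOrbitSpan
    (hlattice : ∀ g : G, ρ g '' intLattice d = intLattice d) {n : ℕ} (Φ : Fin n → L2 d) :
    IsGammaInvariant ρ (gammaOrbitSpan ρ Φ) := by
  intro k g f hf
  have h : gammaOrbitSpan ρ Φ ≤ (gammaOrbitSpan ρ Φ).comap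
      ((shiftOp k).toLinearMap ∘ₗ (rotOp ρ g).toLinearMap) := by
    refine Submodule.span_le.2 ?_
    rintro _ ⟨l, h, i, rfl⟩
    refine Submodule.subset_span ?_
    obtain ⟨l', hl'⟩ : ρ g (intVec l) ∈ intLattice d :=
      (hlattice g).subset (Set.mem_image_of_mem _ ⟨l, rfl⟩)
    refine ⟨k + l', g * h, i, ?_⟩
    change shiftOp k (rotOp ρ g (shiftOp l (rotOp ρ h (Φ i)))) = _
    rw [rotOp_shiftOp ρ hl'.symm, rotOp_rotOp, shiftOp_shiftOp]
  exact h hf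

theorem IsGammaInvariant.topologicalClosure {S : Submodule ℂ (L2 d)}
    (hS : IsGammaInvariant ρ S) : IsGammaInvariant ρ S.topologicalClosure := by
  intro k g f hf
  exact map_mem_closure (f := fun f => shiftOp k (rotOp ρ g f)) ((shiftOp k).continuous.comp (rotOp ρ g).continuous) hf (hS k g)

theorem IsGammaInvariant.shiftOp_mem {S : Submodule ℂ (L2 d)} (hS : IsGammaInvariant ρ S)
    (k : Fin d → ℤ) {f : L2 d} (hf : f ∈ S) : shiftOp k f ∈ S := by
  simpa [rotOp_one] using hS k 1 f hf

theorem IsGammaInvariant.rotOp_mem {S : Submodule ℂ (L2 d)} (hS : IsGammaInvariant ρ S)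
    (g : G) {f : L2 d} (hf : f ∈ S) : rotOp ρ g f ∈ S := by
  simpa [shiftOp_zero] using hS 0 g f hf

theorem isGammaInvariant_gammaSpan (hlattice : ∀ g : G, ρ g '' intLattice d = intLattice d)
    {n : ℕ} (Φ : Fin n → L2 d) : IsGammaInvariant ρ (gammaSpan ρ Φ) :=
  (isGammaInvariant_gammaOrbitSpan hlattice Φ).topologicalClosure

theorem mem_gammaSpan {n : ℕ} (Φ : Fin n → L2 d) (i : Fin n) : Φ i ∈ gammaSpan ρ Φ :=
  Submodule.le_topologicalClosure _ (Submodule.subset_span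
    ⟨0, 1, i, by rw [rotOp_one, shiftOp_zero]⟩)

theorem gammaSpan_le {n : ℕ} {Φ : Fin n → L2 d} {S : Submodule ℂ (L2 d)}
    (hS : IsClosed (S : Set (L2 d))) (hinv : IsGammaInvariant ρ S) (hΦ : ∀ i, Φ i ∈ S) :
    gammaSpan ρ Φ ≤ S := by
  refine Submodule.topologicalClosure_minimal _ (Submodule.span_le.2 ?_) hS
  rintro _ ⟨k, g, i, rfl⟩
  exact hinv k g _ (hΦ i)

theorem gammaSpan_mem_gammaClass (hlattice : ∀ g : G, ρ g '' intLattice d = intLattice d)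
    {n : ℕ} {Φ : Fin n → L2 d} {Ω : Set (Eucl d)} (h : gammaSpan ρ Φ ≤ paleyWiener Ω) :
    gammaSpan ρ Φ ∈ gammaClass ρ n Ω :=
  ⟨Submodule.isClosed_topologicalClosure _, isGammaInvariant_gammaSpan hlattice Φ,
    iInf₂_le n ⟨Φ, rfl⟩, h⟩

theorem mem_paleyWiener {Ω : Set (Eucl d)} {f : L2 d} :
    f ∈ paleyWiener Ω ↔ ∀ᵐ ω : Eucl d, ω ∉ Ω → (𝓕 f : L2 d) ω = 0 := Iff.rfl

theorem isClosed_paleyWiener (Ω : Set (Eucl d)) :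
    IsClosed (paleyWiener Ω : Set (L2 d)) := by
  classical
  have h : Continuous fun f : L2 d => ((𝓕 f : L2 d), (𝓕 f : L2 d)) :=
    (Lp.fourierTransformₗᵢ (Eucl d) ℂ).continuous.prodMk
      (Lp.fourierTransformₗᵢ (Eucl d) ℂ).continuous
  -- Vanishing off `Ω` means `f̂ = 1_Ω f̂`, a closed condition.
  convert (isClosed_setOf_ae_eq_mul (Ω.indicator 1)).preimage h using 1
  ext f
  simp only [SetLike.mem_coe, mem_paleyWiener, Set.mem_preimage, Set.mem_ofPred_eq]
  refine eventually_congr (Eventually.of_forall fun ω => ?_)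
  by_cases hω : ω ∈ Ω <;> simp [hω]

theorem isGammaInvariant_paleyWiener {Ω : Set (Eucl d)} (hΩ : IsFrequencyInvariant ρ Ω) :
    IsGammaInvariant ρ (paleyWiener Ω) := by
  intro k g f hf
  rw [mem_paleyWiener] at hf ⊢
  filter_upwards [fourier_shiftOp k (rotOp ρ g f), fourier_rotOp ρ g f,
    (measurePreserving_freqAct ρ g⁻¹).quasiMeasurePreserving.ae hf] with ω h1 h2 h3 hω
  rw [h1, h2, h3, mul_zero]
  intro h
  apply hω
  have h4 : freqAct ρ g (freqAct ρ g⁻¹ ω) ∈ Ω := (hΩ g).subset (Set.mem_image_of_mem _ h)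
  rwa [← freqAct_mul, mul_inv_cancel, freqAct_one] at h4

/-- The fibers of the elements of the orbit span lie in the span of the fibers of the
generators. -/
theorem ae_fiber_mem_span {n : ℕ} (Φ : Fin n → L2 d) {x : L2 d} (hx : x ∈ gammaOrbitSpan ρ Φ) :
    ∀ᵐ ω ∂cubeMeasure d, fiber (𝓕 x : L2 d) ω ∈ Submodule.span ℂ
      (Set.range fun p : Fin n × G => fiber (𝓕 (rotOp ρ p.2 (Φ p.1)) : L2 d) ω) := by
  induction hx using Submodule.span_induction with
  | mem x hx =>
    obtain ⟨k, g, i, rfl⟩ := hx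
    filter_upwards [ae_memℓp (Lp.memLp (𝓕 (rotOp ρ g (Φ i)) : L2 d)),
      ae_cube_of_ae (fourier_shiftOp k (rotOp ρ g (Φ i)))] with ω h1 h2
    rw [fiber_eq_sum (f := (𝓕 (shiftOp k (rotOp ρ g (Φ i))) : L2 d)) (ι := Unit)
      (a := fun _ => (𝓕 (rotOp ρ g (Φ i)) : L2 d)) (c := fun _ => latChar k ω)
      (fun _ => h1) (fun l => by rw [h2 l, latChar_add_intVec]; simp)]
    exact Submodule.sum_mem _ fun _ _ =>
      Submodule.smul_mem _ _ (Submodule.subset_span ⟨(i, g), rfl⟩)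
  | zero =>
    have h : (𝓕 (0 : L2 d) : L2 d) = 0 := map_zero (Lp.fourierTransformₗᵢ (Eucl d) ℂ)
    filter_upwards [ae_cube_of_ae (Lp.coeFn_zero ℂ 2 (volume : Measure (Eucl d)))] with ω h1
    rw [h, fiber_eq_sum (ι := Empty) (a := fun _ => 0) (c := fun _ => 0) (by simp)
      (fun k => by rw [h1 k]; simp)]
    simp
  | add x y _ _ hx hy =>
    have h : (𝓕 (x + y) : L2 d) = 𝓕 x + 𝓕 y := map_add (Lp.fourierTransformₗᵢ (Eucl d) ℂ) x y
    filter_upwards [hx, hy, ae_memℓp (Lp.memLp (𝓕 x : L2 d)), ae_memℓp (Lp.memLp (𝓕 y : L2 d)),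
      ae_cube_of_ae (Lp.coeFn_add (𝓕 x : L2 d) (𝓕 y : L2 d))] with ω h1 h2 h3 h4 h5
    rw [h, fiber_eq_sum (ι := Fin 2) (a := ![(𝓕 x : L2 d), (𝓕 y : L2 d)]) (c := fun _ => 1)
      (Fin.forall_fin_two.2 ⟨h3, h4⟩) (fun k => by rw [h5 k]; simp)]
    simpa using Submodule.add_mem _ h1 h2
  | smul c x _ hx =>
    have h : (𝓕 (c • x) : L2 d) = c • 𝓕 x := map_smul (Lp.fourierTransformₗᵢ (Eucl d) ℂ) c x
    filter_upwards [hx, ae_memℓp (Lp.memLp (𝓕 x : L2 d)),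
      ae_cube_of_ae (Lp.coeFn_smul c (𝓕 x : L2 d))] with ω h1 h2 h3
    rw [h, fiber_eq_sum (ι := Unit) (a := fun _ => (𝓕 x : L2 d)) (c := fun _ => c)
      (fun _ => h2) (fun k => by rw [h3 k]; simp)]
    simpa using Submodule.smul_mem _ c h1

theorem fiber_sub_ae (x y : L2 d) : ∀ᵐ ω ∂cubeMeasure d,
    fiber (𝓕 (x - y) : L2 d) ω = fiber (𝓕 x : L2 d) ω - fiber (𝓕 y : L2 d) ω := by
  have h : (𝓕 (x - y) : L2 d) = 𝓕 x - 𝓕 y := map_sub (Lp.fourierTransformₗᵢ (Eucl d) ℂ) x y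
  filter_upwards [ae_memℓp (Lp.memLp (𝓕 x : L2 d)), ae_memℓp (Lp.memLp (𝓕 y : L2 d)),
    ae_cube_of_ae (Lp.coeFn_sub (𝓕 x : L2 d) (𝓕 y : L2 d))] with ω h3 h4 h5
  rw [h, fiber_eq_sum (ι := Fin 2) (a := ![(𝓕 x : L2 d), (𝓕 y : L2 d)]) (c := ![1, -1])
    (Fin.forall_fin_two.2 ⟨h3, h4⟩) (fun k => by rw [h5 k]; simp [sub_eq_add_neg])]
  simp [sub_eq_add_neg]

end GammaInvariance

/-! ### Optimal fibers assembled into functions -/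

section Construction

variable {d : ℕ}

theorem volume_unitCube_lt_top (d : ℕ) : volume (unitCube d) < ⊤ := by
  rw [← (PiLp.volume_preserving_toLp (Fin d)).measure_preimage
    (measurableSet_unitCube d).nullMeasurableSet]
  have : (WithLp.toLp 2 : (Fin d → ℝ) → Eucl d) ⁻¹' unitCube d
      = Set.pi Set.univ fun _ => Set.Ioc (0 : ℝ) 1 := by
    ext x
    simp [unitCube]
  rw [this, Real.volume_pi_Ioc]
  exact ENNReal.prod_lt_top fun _ _ => ENNReal.ofReal_lt_top

theorem memLp_of_fiber_bound {f : Eucl d → ℂ} (hf : Measurable f) {B : Eucl d → ENNReal}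
    (hB : ∫⁻ ω, B ω ∂cubeMeasure d < ⊤)
    (h : ∀ᵐ ω ∂cubeMeasure d, Memℓp (fun k => f (ω + intVec k)) 2 ∧ ‖fiber f ω‖ₑ ^ 2 ≤ B ω) :
    MemLp f 2 := by
  refine memLp_two_of_lintegral_lt_top hf.aestronglyMeasurable ?_
  rw [lintegral_eq_lintegral_cube _ (hf.enorm.pow_const 2).aemeasurable]
  refine lt_of_le_of_lt (lintegral_mono_ae ?_) hB
  filter_upwards [h] with ω ⟨h1, h2⟩
  rwa [← enorm_fiber_sq h1]

/-- The finite-dimensional solution is applied to the Gram matrix of the fibers, which is measurable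
and periodic in `ω`, and cut off by `D`. The `Y s` span the optimal subspaces and the `Z p` are the
approximants. The `Y s` are pointwise combinations of the `a p`, so they inherit common zeros. -/
theorem exists_optimal_fibers {ι : Type*} [Fintype ι] (a : ι → L2 d) (n : ℕ) {D : Set (Eucl d)}
    (hD : MeasurableSet D) (hper : ∀ ω k, ω + intVec k ∈ D ↔ ω ∈ D) :
    ∃ (Y : Fin n → L2 d) (Z : ι → L2 d) (c : ι → Fin n → Eucl d → ℂ),
      (∀ p s ω k, c p s (ω + intVec k) = c p s ω) ∧
      (∀ s, ∀ᵐ ω, ω ∉ D → Y s ω = 0) ∧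
      (∀ s, ∀ᵐ ω, (∀ p, a p ω = 0) → Y s ω = 0) ∧
      (∀ p, ∀ᵐ ω, Z p ω = ∑ s, c p s ω * Y s ω) ∧
      ∀ᵐ ω ∂cubeMeasure d, ω ∈ D → ∀ (V : Submodule ℂ (FiberSpace d)) [FiniteDimensional ℂ V],
        Module.finrank ℂ V ≤ n → ∀ b : ι → FiberSpace d, (∀ p, b p ∈ V) →
          ∑ p, ‖fiber (a p) ω - fiber (Z p) ω‖ ^ 2 ≤ ∑ p, ‖fiber (a p) ω - b p‖ ^ 2 := by
  classical
  obtain ⟨U, C, hU, hC, hopt⟩ := exists_measurable_optimal_approximation ι n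
  have ham : ∀ p, Measurable (a p) := fun p => (Lp.stronglyMeasurable (a p)).measurable
  let A : Eucl d → ι → ι → ℂ := fun ω i j =>
    ∑' k : Fin d → ℤ, inner ℂ (a i (ω + intVec k)) (a j (ω + intVec k))
  have hA : Measurable A := by
    refine measurable_pi_lambda _ fun i => measurable_pi_lambda _ fun j => ?_
    refine Measurable.tsum fun k => ?_
    exact ((ham i).comp (measurable_id.add_const _)).inner
      ((ham j).comp (measurable_id.add_const _))
  have hAper : ∀ ω l, A (ω + intVec l) = A ω := by
    intro ω l
    funext i j
    simp only [A, add_assoc, ← intVec_add]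
    exact (Equiv.addLeft l).tsum_eq
      fun k => inner ℂ (a i (ω + intVec k)) (a j (ω + intVec k))
  have hfib : ∀ᵐ ω ∂cubeMeasure d, (∀ p, Memℓp (fun k => a p (ω + intVec k)) 2) ∧
      A ω = gramFun fun p => fiber (a p) ω := by
    filter_upwards [ae_all_iff.2 fun p => ae_memℓp (Lp.memLp (a p))] with ω h
    exact ⟨h, funext fun i => funext fun j => (inner_fiber (h i) (h j)).symm⟩
  let χ : Eucl d → ℂ := D.indicator 1
  have hχ : Measurable χ := measurable_one.indicator hD
  have hχper : ∀ ω k, χ (ω + intVec k) = χ ω := fun ω k => by simp [χ, Set.indicator, hper]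
  have hχle : ∀ ω, ‖χ ω‖ ≤ 1 := fun ω => by
    by_cases h : ω ∈ D <;> simp [χ, h]
  let y : Fin n → Eucl d → ℂ := fun s ω => ∑ j, (χ ω * U (A ω) s j) * a j ω
  let z : ι → Eucl d → ℂ := fun p ω => ∑ s, C (A ω) p s * y s ω
  have hUA : Measurable fun ω => U (A ω) := hU.comp hA
  have hCA : Measurable fun ω => C (A ω) := hC.comp hA
  have hym : ∀ s, Measurable (y s) := fun s => by fun_prop
  have hzm : ∀ p, Measurable (z p) := fun p => by fun_prop
  have hyfib : ∀ᵐ ω ∂cubeMeasure d, ∀ s, Memℓp (fun k => y s (ω + intVec k)) 2 ∧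
      fiber (y s) ω = χ ω • ∑ j, U (A ω) s j • fiber (a j) ω := by
    filter_upwards [hfib] with ω ⟨h1, h2⟩ s
    have h3 : ∀ k, y s (ω + intVec k) = ∑ j, (χ ω * U (A ω) s j) * a j (ω + intVec k) :=
      fun k => by simp only [y, hAper, hχper]
    refine ⟨memℓp_of_eq_sum h1 h3, ?_⟩
    rw [fiber_eq_sum h1 h3, Finset.smul_sum]
    simp only [smul_smul]
  have hzfib : ∀ᵐ ω ∂cubeMeasure d, ∀ p, Memℓp (fun k => z p (ω + intVec k)) 2 ∧
      fiber (z p) ω = χ ω • ∑ s, C (A ω) p s • ∑ j, U (A ω) s j • fiber (a j) ω := by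
    filter_upwards [hyfib] with ω h1 p
    have h3 : ∀ k, z p (ω + intVec k) = ∑ s, C (A ω) p s * y s (ω + intVec k) :=
      fun k => by simp only [z, hAper]
    refine ⟨memℓp_of_eq_sum (fun s => (h1 s).1) h3, ?_⟩
    rw [fiber_eq_sum (fun s => (h1 s).1) h3, Finset.smul_sum]
    simp only [(h1 _).2, smul_comm (χ ω)]
  have hyL : ∀ s, MemLp (y s) 2 := by
    intro s
    -- The spanning vectors have norm at most one and the cube has finite volume.
    refine memLp_of_fiber_bound (hym s) (B := fun _ => 1) ?_ ?_
    · simpa using volume_unitCube_lt_top d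
    · filter_upwards [hfib, hyfib] with ω ⟨_, h2⟩ h3
      refine ⟨(h3 s).1, ?_⟩
      rw [(h3 s).2, h2, ← ofReal_norm, ← ENNReal.ofReal_pow (norm_nonneg _),
        ENNReal.ofReal_le_one, norm_smul]
      exact pow_le_one₀ (by positivity)
        (mul_le_one₀ (hχle ω) (norm_nonneg _) ((hopt fun p => fiber (a p) ω).1 s))
  have hzL : ∀ p, MemLp (z p) 2 := by
    intro p
    -- Comparison with the zero subspace bounds the error by `σ = ∑ ‖a q‖²`, so the approximant has
    -- norm at most `2√σ`; hence the constant 4.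
    refine memLp_of_fiber_bound (hzm p)
      (B := fun ω => 4 * ∑ q, ‖fiber (a q) ω‖ₑ ^ 2) ?_ ?_
    · rw [lintegral_const_mul' _ _ (by norm_num), lintegral_finsetSum' _ fun q _ =>
        aemeasurable_enorm_fiber_sq (Lp.memLp (a q))]
      refine ENNReal.mul_lt_top (by norm_num) (ENNReal.sum_lt_top.2 fun q _ => ?_)
      rw [← lintegral_enorm_sq_eq_fiber (Lp.memLp (a q))]
      exact lintegral_enorm_sq_lt_top (Lp.memLp (a q))
    · filter_upwards [hfib, hzfib] with ω ⟨_, h2⟩ h3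
      refine ⟨(h3 p).1, ?_⟩
      rw [(h3 p).2, h2]
      set t := ∑ s, C (gramFun fun p => fiber (a p) ω) p s •
        ∑ j, U (gramFun fun p => fiber (a p) ω) s j • fiber (a j) ω with ht
      set σ := ∑ q, ‖fiber (a q) ω‖ ^ 2 with hσ
      have h4 := (hopt fun p => fiber (a p) ω).2 ⊥ (by simp) 0 (by simp)
      simp only [Pi.zero_apply, sub_zero] at h4
      have h5 : ‖fiber (a p) ω - t‖ ^ 2 ≤ σ :=
        (Finset.single_le_sum (f := fun q => ‖fiber (a q) ω -
          ∑ s, C (gramFun fun p => fiber (a p) ω) q s •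
            ∑ j, U (gramFun fun p => fiber (a p) ω) s j • fiber (a j) ω‖ ^ 2)
          (fun q _ => sq_nonneg _) (Finset.mem_univ p)).trans h4
      have h6 : ‖fiber (a p) ω‖ ^ 2 ≤ σ :=
        Finset.single_le_sum (f := fun q => ‖fiber (a q) ω‖ ^ 2)
          (fun q _ => sq_nonneg _) (Finset.mem_univ p)
      have h7 : ‖t‖ ≤ ‖fiber (a p) ω‖ + ‖fiber (a p) ω - t‖ := by
        have := norm_sub_le (fiber (a p) ω) (fiber (a p) ω - t)
        rwa [sub_sub_cancel] at this
      have h8 : ‖χ ω • t‖ ≤ ‖t‖ := by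
        rw [norm_smul]
        exact mul_le_of_le_one_left (norm_nonneg _) (hχle ω)
      have h9 : ‖χ ω • t‖ ^ 2 ≤ 4 * σ := by
        have h10 := pow_le_pow_left₀ (norm_nonneg _) (h8.trans h7) 2
        nlinarith [sq_nonneg (‖fiber (a p) ω‖ - ‖fiber (a p) ω - t‖)]
      have h11 := ENNReal.ofReal_le_ofReal h9
      rw [ENNReal.ofReal_pow (norm_nonneg _), ofReal_norm, ENNReal.ofReal_mul (by norm_num),
        hσ, ENNReal.ofReal_sum_of_nonneg fun q _ => sq_nonneg _] at h11
      simpa only [ENNReal.ofReal_pow (norm_nonneg _), ofReal_norm, ENNReal.ofReal_ofNat] using h11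
  refine ⟨fun s => (hyL s).toLp, fun p => (hzL p).toLp, fun p s ω => C (A ω) p s,
    fun p s ω k => by simp only [hAper], fun s => ?_, fun s => ?_, fun p => ?_, ?_⟩
  · filter_upwards [(hyL s).coeFn_toLp] with ω h1 h2
    rw [h1]
    simp [y, χ, h2]
  · filter_upwards [(hyL s).coeFn_toLp] with ω h1 h2
    rw [h1]
    simp [y, h2]
  · filter_upwards [(hzL p).coeFn_toLp, ae_all_iff.2 fun s => (hyL s).coeFn_toLp] with ω h1 h2
    rw [h1]
    simp only [h2, z]
  · filter_upwards [hfib, hzfib, ae_all_iff.2 fun p => ae_cube_of_ae (hzL p).coeFn_toLp]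
      with ω ⟨_, h2⟩ h3 h4 hω V _ hV b hb
    have h5 : χ ω = 1 := by simp [χ, hω]
    simp only [fiber_congr (h4 _), (h3 _).2, h5, one_smul, h2]
    exact (hopt fun p => fiber (a p) ω).2 V hV b hb

theorem exists_fourier_eq (f : L2 d) : ∃ x : L2 d, 𝓕 x = f :=
  (Lp.fourierTransformₗᵢ (Eucl d) ℂ).surjective f

end Construction

/-! ### Packing the generators and comparing errors -/

section Main

variable {d : ℕ} {G : Type*} [Group G] {ρ : G →* (Eucl d ≃L[ℝ] Eucl d)}

theorem ae_fourier_sum {ι : Type*} [Fintype ι] (w : ι → L2 d) :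
    ∀ᵐ ω, (𝓕 (∑ i, w i) : L2 d) ω = ∑ i, (𝓕 (w i) : L2 d) ω := by
  have h : (𝓕 (∑ i, w i) : L2 d) = ∑ i, 𝓕 (w i) :=
    map_sum (Lp.fourierTransformₗᵢ (Eucl d) ℂ) w Finset.univ
  rw [h]
  filter_upwards [Lp.coeFn_finsetSum Finset.univ fun i => (𝓕 (w i) : L2 d)] with ω hω
  simpa using hω

/-- The transform of `R_(h g⁻¹) w_g` lives on the image of `D` under `h g⁻¹`, which meets `D` only
for `g = h`. Thus one function stores `|G|` independent pieces. -/
theorem fourier_rotOp_sum_rotOp_inv [Fintype G] {D : Set (Eucl d)}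
    (hdisj : ∀ ω g h, freqAct ρ g ω ∈ D → freqAct ρ h ω ∈ D → g = h) {w : G → L2 d}
    (hw : ∀ g, ∀ᵐ ω, ω ∉ D → (𝓕 (w g) : L2 d) ω = 0) (h : G) :
    ∀ᵐ ω, ω ∈ D → (𝓕 (rotOp ρ h (∑ g, rotOp ρ g⁻¹ (w g))) : L2 d) ω = (𝓕 (w h) : L2 d) ω := by
  have h1 : rotOp ρ h (∑ g, rotOp ρ g⁻¹ (w g)) = ∑ g, rotOp ρ (h * g⁻¹) (w g) := by
    simp only [map_sum, rotOp_rotOp]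
  rw [h1]
  filter_upwards [ae_fourier_sum fun g => rotOp ρ (h * g⁻¹) (w g),
    ae_all_iff.2 fun g => fourier_rotOp ρ (h * g⁻¹) (w g),
    ae_all_iff.2 fun g => (measurePreserving_freqAct ρ (h * g⁻¹)⁻¹).quasiMeasurePreserving.ae
      (hw g)] with ω h2 h3 h4 hω
  rw [h2, Finset.sum_eq_single h, h3, mul_inv_cancel, inv_one, freqAct_one]
  · intro g _ hg
    rw [h3]
    refine h4 g fun hmem => hg ?_
    have := hdisj ω _ 1 hmem (by rwa [freqAct_one])
    rw [inv_eq_one, mul_inv_eq_one] at this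
    exact this.symm
  · simp

theorem approxError_le [Finite G] {m n : ℕ} (F : Fin m → L2 d) (Φ : Fin n → L2 d)
    {s : Fin m → L2 d} (hs : ∀ i, s i ∈ gammaSpan ρ Φ) :
    approxError F (gammaSpan ρ Φ) ≤ ∑ i, ‖F i - s i‖ ^ 2 := by
  refine Finset.sum_le_sum fun i _ => ?_
  gcongr
  rw [Submodule.starProjection_minimal]
  exact ciInf_le ⟨0, Set.forall_mem_range.2 fun _ => norm_nonneg _⟩
    (⟨s i, hs i⟩ : gammaSpan ρ Φ)

/-- By continuity it suffices to test the dense algebraic span, whose elements have fibers in the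
span of the generators' fibers. -/
theorem le_approxError [Finite G] {m n : ℕ} (F : Fin m → L2 d) (Ψ : Fin n → L2 d) {C : ℝ}
    (h : ∀ t : Fin m → L2 d, (∀ i, t i ∈ gammaOrbitSpan ρ Ψ) → C ≤ ∑ i, ‖F i - t i‖ ^ 2) :
    C ≤ approxError F (gammaSpan ρ Ψ) := by
  have hcl : IsClosed {t : Fin m → L2 d | C ≤ ∑ i, ‖F i - t i‖ ^ 2} :=
    isClosed_le continuous_const (by fun_prop)
  have hsub : Set.pi Set.univ (fun _ : Fin m => (gammaOrbitSpan ρ Ψ : Set (L2 d)))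
      ⊆ {t : Fin m → L2 d | C ≤ ∑ i, ‖F i - t i‖ ^ 2} := fun t ht => h t fun i => ht i trivial
  refine hcl.closure_subset_iff.2 hsub ?_
  rw [closure_pi_set]
  exact fun i _ => (gammaSpan ρ Ψ).starProjection_apply_mem (F i)

theorem sum_enorm_sq_le_iff {ι E : Type*} [Fintype ι] [SeminormedAddCommGroup E] {x y : ι → E} :
    ∑ i, ‖x i‖ₑ ^ 2 ≤ ∑ i, ‖y i‖ₑ ^ 2 ↔ ∑ i, ‖x i‖ ^ 2 ≤ ∑ i, ‖y i‖ ^ 2 := by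
  have h : ∀ x : ι → E, ∑ i, ‖x i‖ₑ ^ 2 = ENNReal.ofReal (∑ i, ‖x i‖ ^ 2) := fun x => by
    rw [ENNReal.ofReal_sum_of_nonneg fun _ _ => sq_nonneg _]
    simp only [ENNReal.ofReal_pow (norm_nonneg _), ofReal_norm]
  rw [h, h, ENNReal.ofReal_le_ofReal_iff (Finset.sum_nonneg fun _ _ => sq_nonneg _)]

theorem exists_optimal_of_mem_paleyWiener [Finite G] {m : ℕ} (ℓ : ℕ) (hρ : Function.Injective ρ)
    (hlattice : ∀ g : G, ρ g '' intLattice d = intLattice d) {Ω : Set (Eucl d)}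
    (hΩ : IsFrequencyInvariant ρ Ω) {F : Fin m → L2 d} (hF : ∀ i, F i ∈ paleyWiener Ω) :
    ∃ Φ : Fin ℓ → L2 d, gammaSpan ρ Φ ≤ paleyWiener Ω ∧ ∀ Ψ : Fin ℓ → L2 d,
      approxError F (gammaSpan ρ Φ) ≤ approxError F (gammaSpan ρ Ψ) := by
  classical
  have := Fintype.ofFinite G
  obtain ⟨D, hD, hper, hdisj, hcov⟩ := exists_frequencyDomain ρ hρ hlattice
  have hPW := isGammaInvariant_paleyWiener hΩ
  let e := Fintype.equivFin (Fin ℓ × G)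
  obtain ⟨Y, Z, c, hc, hYD, hYa, hZ, hopt⟩ := exists_optimal_fibers
    (fun p : Fin m × G => (𝓕 (rotOp ρ p.2 (F p.1)) : L2 d)) (Fintype.card (Fin ℓ × G)) hD hper
  choose y hy using fun q => exists_fourier_eq (Y (e q))
  choose z hz using fun p => exists_fourier_eq (Z p)
  let Φ : Fin ℓ → L2 d := fun i => ∑ g, rotOp ρ g⁻¹ (y (i, g))
  let s : Fin m → L2 d := fun i => ∑ g, rotOp ρ g⁻¹ (z (i, g))
  have hyD : ∀ q, ∀ᵐ ω, ω ∉ D → (𝓕 (y q) : L2 d) ω = 0 := fun q => by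
    rw [hy]
    exact hYD _
  have hzD : ∀ p, ∀ᵐ ω, ω ∉ D → (𝓕 (z p) : L2 d) ω = 0 := fun p => by
    rw [hz]
    filter_upwards [hZ p, ae_all_iff.2 hYD] with ω h1 h2 hω
    rw [h1]
    exact Finset.sum_eq_zero fun s _ => by rw [h2 s hω, mul_zero]
  have hyΩ : ∀ q, y q ∈ paleyWiener Ω := fun q => by
    rw [mem_paleyWiener, hy]
    filter_upwards [hYa (e q), ae_all_iff.2 fun p : Fin m × G =>
      mem_paleyWiener.1 (hPW.rotOp_mem p.2 (hF p.1))] with ω h1 h2 hω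
    exact h1 fun p => h2 p hω
  have hinv := isGammaInvariant_gammaSpan hlattice Φ
  have hclosed : IsClosed (gammaSpan ρ Φ : Set (L2 d)) :=
    Submodule.isClosed_topologicalClosure _
  -- In frequency, `y (i, g)` is `R_g φ_i` times the periodic indicator of `D`.
  have hyS : ∀ q, y q ∈ gammaSpan ρ Φ := by
    rintro ⟨i, g⟩
    refine mem_of_fourier_eq_sum hclosed (fun k _ => hinv.shiftOp_mem k) (ι := Unit)
      (w := fun _ => rotOp ρ g (Φ i)) (fun _ => hinv.rotOp_mem g (mem_gammaSpan Φ i))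
      (c := fun _ => D.indicator 1) (fun _ ω k => by simp [Set.indicator, hper]) ?_
    filter_upwards [fourier_rotOp_sum_rotOp_inv hdisj (fun g => hyD (i, g)) g, hyD (i, g)]
      with ω h1 h2
    by_cases hω : ω ∈ D
    · simp [hω, ← h1 hω, Φ]
    · simp [hω, h2 hω]
  have hzS : ∀ p, z p ∈ gammaSpan ρ Φ := by
    intro p
    refine mem_of_fourier_eq_sum hclosed (fun k _ => hinv.shiftOp_mem k)
      (w := fun s => y (e.symm s)) (fun s => hyS _) (c := c p) (hc p) ?_
    simp only [hy, hz, Equiv.apply_symm_apply]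
    exact hZ p
  have hsS : ∀ i, s i ∈ gammaSpan ρ Φ := fun i =>
    Submodule.sum_mem _ fun g _ => hinv.rotOp_mem _ (hzS _)
  refine ⟨Φ, gammaSpan_le (isClosed_paleyWiener Ω) hPW fun i =>
    Submodule.sum_mem _ fun g _ => hPW.rotOp_mem _ (hyΩ _), fun Ψ => ?_⟩
  -- The explicit approximants `s i` bound the error of `Φ`. On `D` the fibers of `R_g s_i` are the
  -- optimal `Z (i, g)`, so they can be compared pointwise with those of `R_g t_i`.
  refine (approxError_le F Φ hsS).trans (le_approxError F Ψ fun t ht => ?_)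
  rw [← sum_enorm_sq_le_iff, sum_enorm_sq_eq_lintegral_fiber ρ hD hper hdisj hcov,
    sum_enorm_sq_eq_lintegral_fiber ρ hD hper hdisj hcov]
  refine lintegral_mono_ae ?_
  have hspan := isGammaInvariant_gammaOrbitSpan hlattice Ψ
  filter_upwards [hopt,
    ae_all_iff.2 fun p : Fin m × G =>
      fiber_sub_ae (rotOp ρ p.2 (F p.1)) (rotOp ρ p.2 (s p.1)),
    ae_all_iff.2 fun p : Fin m × G =>
      fiber_sub_ae (rotOp ρ p.2 (F p.1)) (rotOp ρ p.2 (t p.1)),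
    ae_all_iff.2 fun p : Fin m × G =>
      ae_fiber_mem_span Ψ (hspan.rotOp_mem p.2 (ht p.1)),
    ae_all_iff.2 fun p : Fin m × G => ae_cube_of_ae
      (fourier_rotOp_sum_rotOp_inv hdisj (fun g => hzD (p.1, g)) p.2)] with ω h1 h2 h3 h4 h5
  by_cases hω : ω ∈ D
  · simp only [Set.indicator_of_mem hω, map_sub, h2, h3]
    rw [sum_enorm_sq_le_iff]
    have h6 : ∀ p : Fin m × G, fiber (𝓕 (rotOp ρ p.2 (s p.1)) : L2 d) ω = fiber (Z p) ω := by
      intro p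
      rw [← hz p]
      exact fiber_congr fun k => h5 p k ((hper ω k).2 hω)
    simp only [h6]
    have := FiniteDimensional.span_of_finite ℂ (Set.finite_range fun p : Fin ℓ × G =>
      fiber (𝓕 (rotOp ρ p.2 (Ψ p.1)) : L2 d) ω)
    -- The competitor's fibers lie in a span of `ℓ|G|` vectors, the dimension for which `Z` is
    -- optimal.
    exact h1 hω _ (finrank_range_le_card _) _ h4
  · simp [hω]

/-- Pythagoras: the first term does not depend on `S`, so minimizing over subspaces of `P` only
involves the projected data. -/
theorem approxError_eq_of_le {m : ℕ} (F : Fin m → L2 d) {S P : Submodule ℂ (L2 d)}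
    [S.HasOrthogonalProjection] [P.HasOrthogonalProjection] (h : S ≤ P) :
    approxError F S = ∑ i, ‖F i - P.starProjection (F i)‖ ^ 2
      + approxError (fun i => P.starProjection (F i)) S := by
  rw [approxError, approxError, ← Finset.sum_add_distrib]
  refine Finset.sum_congr rfl fun i _ => ?_
  have h1 : S.starProjection (P.starProjection (F i)) = S.starProjection (F i) :=
    DFunLike.congr_fun (Submodule.starProjection_comp_starProjection_of_le h) (F i)
  have h2 := norm_add_sq_eq_norm_sq_add_norm_sq_of_inner_eq_zero (𝕜 := ℂ)
    (F i - P.starProjection (F i)) (P.starProjection (F i) - S.starProjection (F i))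
    (P.starProjection_inner_eq_zero _ _ (P.sub_mem (P.starProjection_apply_mem _)
      (h (S.starProjection_apply_mem _))))
  rw [sub_add_sub_cancel] at h2
  rw [h1]
  linarith

end Main

end

theorem mainTheorem2 {d m ℓ : ℕ} (hℓ : 0 < ℓ) {G : Type*} [Group G] [Finite G]
    (ρ : G →* (Eucl d ≃L[ℝ] Eucl d)) (hfaithful : Function.Injective ρ)
    (hlattice : ∀ g : G, ρ g '' intLattice d = intLattice d)
    (Ω : Set (Eucl d)) (hΩ : MeasurableSet Ω) (hΩinv : IsFrequencyInvariant ρ Ω)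
    (F : Fin m → L2 d) :
    ∃ Φ : Fin ℓ → L2 d,
      gammaSpan ρ Φ ∈ gammaClass ρ ℓ Ω ∧
      ∀ Ψ : Fin ℓ → L2 d, (∀ i, Ψ i ∈ paleyWiener Ω) →
        approxError F (gammaSpan ρ Φ) ≤ approxError F (gammaSpan ρ Ψ) := by
  have hcl := isClosed_paleyWiener Ω
  have : CompleteSpace (paleyWiener Ω) := hcl.completeSpace_coe
  obtain ⟨Φ, hΦ, hopt⟩ := exists_optimal_of_mem_paleyWiener ℓ hfaithful hlattice hΩinv
    (F := fun i => (paleyWiener Ω).starProjection (F i))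
    fun i => (paleyWiener Ω).starProjection_apply_mem (F i)
  refine ⟨Φ, gammaSpan_mem_gammaClass hlattice hΦ, fun Ψ hΨ => ?_⟩
  rw [approxError_eq_of_le F hΦ, approxError_eq_of_le F
    (gammaSpan_le hcl (isGammaInvariant_paleyWiener hΩinv) hΨ)]
  exact add_le_add_right (hopt Ψ) _
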